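/- Let $X$ be a compact Riemann surface with canonical bundle $K$, equipped with a Kähler metric with area form $\sigma$. Let $Q=(V,E,h,t)$ be a finite quiver (an edge $a$ goes from $t(a)$ to $h(a)$), and let $(\mathcal{E}_v)_{v\in V}$ be smooth Hermitian complex vector bundles on $X$. Put $$\mathrm{Rep}(E(\overline{Q}))=\bigoplus_{a\in E}\Big(\Omega^0(X,\mathrm{Hom}(\mathcal{E}_{t(a)},\mathcal{E}_{h(a)}))\oplus\Omega^{0,1}(X,\mathrm{Hom}(\mathcal{E}_{h(a)},\mathcal{E}_{t(a)})\otimes K)\Big),$$ where $\Omega^{0,1}(X,W\otimes K)=\Omega^{1,1}(X,W)$ is the space of smooth $W$-valued two-forms. For a two-form $y_a$ write $y_a=(\star y_a)\,\sigma$, and let $y_a'^*y_a$ and $y_ay_a'^*$ denote the endomorphisms $(\star y_a')^*(\star y_a)$ and $(\star y_a)(\star y_a')^*$. Let $\mathcal{G}=\prod_v\mathrm{Aut}(\mathcal{E}_v)$ be the group of smooth unitary automorphisms, with Lie algebra $\mathfrak{g}$ (smooth skew-adjoint endomorphisms $\theta=(\theta_v)_v$), acting by $$g\cdot(x,y)=(g_{h(a)}x_ag_{t(a)}^{-1},\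 g_{t(a)}y_ag_{h(a)}^{-1})_a .$$ Consider the real and complex symplectic forms $$\omega_{\mathbb R}((x,y),(x',y'))=2\,\mathrm{Im}\sum_a\int_X\mathrm{tr}\big(x_ax_a'^*+y_a'^*y_a\big)\,\sigma,\qquad \omega_{\mathbb C}((x,y),(x',y'))=\sum_a\int_X\mathrm{tr}\big(x_ay_a'-x_a'y_a\big).$$ **Proposition.** The infinitesimal action of $\theta\in\mathfrak{g}$, $\frac{d}{dt}\big|_{t=0}\exp(t\theta)\cdot(x,y)$ (computed pointwise on $X$), is the vector field $$\xi_\theta(x,y)=(\theta_{h(a)}x_a-x_a\theta_{t(a)},\ \theta_{t(a)}y_a-y_a\theta_{h(a)})_a.$$ The forms $\omega_{\mathbb R}$ and $\omega_{\mathbb C}$ are, respectively, $\mathbb R$-bilinear and $\mathbb C$-bilinear, skew-symmetric, weakly non-degenerate and $\mathcal{G}$-invariant, and the $\mathcal{G}$-action is Hamiltonian for both, with moment maps whose components at the vertex $i$ are $$\mu_{\mathbb R}(x,y)_i=\sum_{h(a)=i}(x_ax_a^*-y_a^*y_a)-\sum_{t(a)=i}(x_a^*x_a-y_ay_a^*),\qquad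 \mu_{\mathbb C}(x,y)_i=\sum_{h(a)=i}x_ay_a-\sum_{t(a)=i}y_ax_a .$$ Explicitly: $\mu_{\mathbb R}(x,y)_i$ is a smooth self-adjoint endomorphism of $\mathcal{E}_i$ and $\mu_{\mathbb C}(x,y)_i$ is a smooth $\mathrm{End}(\mathcal{E}_i)$-valued two-form; with the pairings $$\langle\mu_{\mathbb R},\theta\rangle=\frac{1}{\sqrt{-1}}\sum_i\int_X\mathrm{tr}(\theta_i\,\mu_{\mathbb R,i})\,\sigma\in\mathbb R,\qquad \langle\mu_{\mathbb C},\theta\rangle=\sum_i\int_X\mathrm{tr}(\theta_i\,\mu_{\mathbb C,i})\in\mathbb C,$$ which are real-linear in $\theta\in\mathfrak{g}$, one has, for $\bullet\in\{\mathbb R,\mathbb C\}$, every point $z=(x,y)$, every direction $w$, every $\theta\in\mathfrak{g}$ and every $g\in\mathcal{G}$, $$d\langle\mu_\bullet,\theta\rangle_z(w)=\omega_\bullet(\xi_\theta(z),w),\qquad \langle\mu_\bullet(g\cdot z),\,g\theta g^{-1}\rangle=\langle\mu_\bullet(z),\theta\rangle .$$ Here $d\langle\mu_\bullet,\theta\rangle_z(w)$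 is the directional derivative, along a real parameter for $\bullet=\mathbb R$ and a complex one for $\bullet=\mathbb C$. -/

import Mathlib

open Set Bundle Manifold ContDiff

noncomputable section

namespace QuiverBundle

universe u v w

/-- The model fibre of a bundle of rank `r`. -/
abbrev ModelFiber (r : ℕ) : Type := EuclideanSpace ℂ (Fin r)

/-- A smooth Hermitian vector bundle (of constant rank) over a surface `X` with an atlas of
`ℂ`-valued charts. Only the underlying *real* smooth structure of `X` enters: the coordinate changes
are fibrewise `ℂ`-linear and smooth in the real sense, and the fibrewise Hermitian inner product
is smooth in local trivializations. -/
structure HermitianBundle (X : Type u) [TopologicalSpace X] [ChartedSpace ℂ X] where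
  rank : ℕ
  Fiber : X → Type v
  [normed : ∀ p, NormedAddCommGroup (Fiber p)]
  [innerProduct : ∀ p, InnerProductSpace ℂ (Fiber p)]
  [topTotal : TopologicalSpace (TotalSpace (ModelFiber rank) Fiber)]
  [fiberBundle : FiberBundle (ModelFiber rank) Fiber]
  [vectorBundle : VectorBundle ℂ (ModelFiber rank) Fiber]
  smooth_coordChange :
    ∀ (e e' : Trivialization (ModelFiber rank) (π (ModelFiber rank) Fiber))
      [MemTrivializationAtlas e] [MemTrivializationAtlas e'],
      ContMDiffOn 𝓘(ℝ, ℂ) 𝓘(ℝ, ModelFiber rank →L[ℂ] ModelFiber rank) ∞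
        (fun p => (e.coordChangeL ℂ e' p : ModelFiber rank →L[ℂ] ModelFiber rank))
        (e.baseSet ∩ e'.baseSet)
  smooth_metric :
    ∀ (e : Trivialization (ModelFiber rank) (π (ModelFiber rank) Fiber))
      [MemTrivializationAtlas e] (s t : ModelFiber rank),
      ContMDiffOn 𝓘(ℝ, ℂ) 𝓘(ℝ, ℂ) ∞
        (fun p => (inner ℂ (e.symm p s) (e.symm p t) : ℂ)) e.baseSet

attribute [instance] HermitianBundle.normed HermitianBundle.innerProduct
  HermitianBundle.topTotal HermitianBundle.fiberBundle HermitianBundle.vectorBundle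

variable {X : Type u} [TopologicalSpace X] [ChartedSpace ℂ X]

/-- The preferred local trivialization around `b`. -/
abbrev HermitianBundle.triv (E : HermitianBundle.{u, v} X) (b : X) :
    Trivialization (ModelFiber E.rank) (π (ModelFiber E.rank) E.Fiber) :=
  trivializationAt (ModelFiber E.rank) E.Fiber b

instance (E : HermitianBundle.{u, v} X) (p : X) : FiniteDimensional ℂ (E.Fiber p) :=
  LinearEquiv.finiteDimensional
    ((E.triv p).continuousLinearEquivAt ℂ p
      (FiberBundle.mem_baseSet_trivializationAt' p)).symm.toLinearEquiv

instance (E : HermitianBundle.{u, v} X) (p : X) : CompleteSpace (E.Fiber p) :=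
  FiniteDimensional.complete ℂ (E.Fiber p)

instance (r s : ℕ) : NormedSpace ℝ (ModelFiber r →L[ℂ] ModelFiber s) := NormedSpace.complexToReal

instance (E F : HermitianBundle.{u, v} X) (p : X) :
    NormedSpace ℝ (E.Fiber p →L[ℂ] F.Fiber p) := NormedSpace.complexToReal

instance (E : HermitianBundle.{u, v} X) (p : X) : ContinuousSMul ℂ (E.Fiber p) :=
  IsBoundedSMul.continuousSMul

instance (E F : HermitianBundle.{u, v} X) (p : X) :
    ContinuousSMul ℝ (E.Fiber p →L[ℂ] F.Fiber p) := IsBoundedSMul.continuousSMul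

/-- The matrix of a fibre map `A : E_p → F_p` in the trivializations of `E` around `b` and of `F`
around `c`. -/
def localRep (E F : HermitianBundle.{u, v} X) (b c p : X) (A : E.Fiber p →L[ℂ] F.Fiber p) :
    ModelFiber E.rank →L[ℂ] ModelFiber F.rank :=
  ContinuousLinearMap.inCoordinates (ModelFiber E.rank) E.Fiber (ModelFiber F.rank) F.Fiber
    b p c p A

/-- Smoothness over an open set `U` of a section of `Hom(E, F)`: it is smooth in local
trivializations. -/
def IsSmoothHomOn (E F : HermitianBundle.{u, v} X) (U : Set X)
    (x : ∀ p, E.Fiber p →L[ℂ] F.Fiber p) : Prop :=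
  ∀ b c : X, ContMDiffOn 𝓘(ℝ, ℂ) 𝓘(ℝ, ModelFiber E.rank →L[ℂ] ModelFiber F.rank) ∞
    (fun p => localRep E F b c p (x p)) (U ∩ ((E.triv b).baseSet ∩ (F.triv c).baseSet))

/-! ### Closure properties of smooth sections -/

section smooth

variable {E F G : HermitianBundle.{u, v} X} {U : Set X}

theorem localRep_add (b c p : X) (A B : E.Fiber p →L[ℂ] F.Fiber p) :
    localRep E F b c p (A + B) = localRep E F b c p A + localRep E F b c p B := by
  ext w; simp [localRep, ContinuousLinearMap.inCoordinates]

theorem localRep_smul (b c p : X) (k : ℂ) (A : E.Fiber p →L[ℂ] F.Fiber p) :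
    localRep E F b c p (k • A) = k • localRep E F b c p A := by
  ext w; simp [localRep, ContinuousLinearMap.inCoordinates]

theorem localRep_comp (b d c p : X) (hd : p ∈ (F.triv d).baseSet)
    (B : F.Fiber p →L[ℂ] G.Fiber p) (A : E.Fiber p →L[ℂ] F.Fiber p) :
    localRep E G b c p (B ∘L A) = localRep F G d c p B ∘L localRep E F b d p A := by
  ext1 w
  have h := Trivialization.symmL_continuousLinearMapAt (R := ℂ) (F.triv d) hd
    (A ((E.triv b).symmL ℂ p w))
  change _ = (G.triv c).continuousLinearMapAt ℂ p (B ((F.triv d).symmL ℂ p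
    ((F.triv d).continuousLinearMapAt ℂ p (A ((E.triv b).symmL ℂ p w)))))
  rw [h]
  rfl

theorem IsSmoothHomOn.add {x y : ∀ p, E.Fiber p →L[ℂ] F.Fiber p}
    (hx : IsSmoothHomOn E F U x) (hy : IsSmoothHomOn E F U y) :
    IsSmoothHomOn E F U (fun p => x p + y p) := by
  intro b c
  simp only [localRep_add]
  exact (hx b c).add (hy b c)

theorem IsSmoothHomOn.smul {f : X → ℂ} (hf : ContMDiffOn 𝓘(ℝ, ℂ) 𝓘(ℝ, ℂ) ∞ f U)
    {x : ∀ p, E.Fiber p →L[ℂ] F.Fiber p} (hx : IsSmoothHomOn E F U x) :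
    IsSmoothHomOn E F U (fun p => f p • x p) := by
  intro b c
  simp only [localRep_smul]
  have h : ContDiff ℝ ∞ (fun q : ℂ × (ModelFiber E.rank →L[ℂ] ModelFiber F.rank) => q.1 • q.2) :=
    contDiff_smul
  exact h.contMDiff.comp_contMDiffOn
    ((hf.mono inter_subset_left).prodMk_space (hx b c))

theorem IsSmoothHomOn.zero : IsSmoothHomOn E F U (fun _ => 0) := by
  intro b c
  have : ∀ p, localRep E F b c p 0 = 0 := fun p => by
    ext w; simp [localRep, ContinuousLinearMap.inCoordinates]
  simp only [this]
  exact contMDiffOn_const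

theorem IsSmoothHomOn.mono {V : Set X} (hUV : V ⊆ U) {x : ∀ p, E.Fiber p →L[ℂ] F.Fiber p}
    (hx : IsSmoothHomOn E F U x) : IsSmoothHomOn E F V x :=
  fun b c => (hx b c).mono (inter_subset_inter_left _ hUV)

theorem contMDiffOn_clmComp {r s t : ℕ} {S : Set X}
    {B : X → (ModelFiber s →L[ℂ] ModelFiber t)} {A : X → (ModelFiber r →L[ℂ] ModelFiber s)}
    (hB : ContMDiffOn 𝓘(ℝ, ℂ) 𝓘(ℝ, ModelFiber s →L[ℂ] ModelFiber t) ∞ B S)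
    (hA : ContMDiffOn 𝓘(ℝ, ℂ) 𝓘(ℝ, ModelFiber r →L[ℂ] ModelFiber s) ∞ A S) :
    ContMDiffOn 𝓘(ℝ, ℂ) 𝓘(ℝ, ModelFiber r →L[ℂ] ModelFiber t) ∞ (fun p => B p ∘L A p) S := by
  have h : ContDiff ℝ ∞ (fun q : (ModelFiber s →L[ℂ] ModelFiber t) ×
      (ModelFiber r →L[ℂ] ModelFiber s) => q.1 ∘L q.2) :=
    ((ContinuousLinearMap.compL ℂ (ModelFiber r) (ModelFiber s)
      (ModelFiber t)).bilinearRestrictScalars ℝ).isBoundedBilinearMap.contDiff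
  exact h.contMDiff.comp_contMDiffOn (hB.prodMk_space hA)

theorem IsSmoothHomOn.comp {y : ∀ p, F.Fiber p →L[ℂ] G.Fiber p}
    {x : ∀ p, E.Fiber p →L[ℂ] F.Fiber p}
    (hy : IsSmoothHomOn F G U y) (hx : IsSmoothHomOn E F U x) :
    IsSmoothHomOn E G U (fun p => y p ∘L x p) := by
  intro b c p hp
  have hpd : p ∈ (F.triv p).baseSet := FiberBundle.mem_baseSet_trivializationAt' p
  have key : ContMDiffOn 𝓘(ℝ, ℂ) 𝓘(ℝ, ModelFiber E.rank →L[ℂ] ModelFiber G.rank) ∞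
      (fun q => localRep E G b c q (y q ∘L x q))
      ((U ∩ ((E.triv b).baseSet ∩ (G.triv c).baseSet)) ∩ (F.triv p).baseSet) := by
    refine (contMDiffOn_clmComp ((hy p c).mono ?_) ((hx b p).mono ?_)).congr
      (fun q hq => localRep_comp b p c q hq.2 _ _)
    · rintro q ⟨⟨h1, h2, h3⟩, h4⟩; exact ⟨h1, h4, h3⟩
    · rintro q ⟨⟨h1, h2, h3⟩, h4⟩; exact ⟨h1, h2, h4⟩
  exact (contMDiffWithinAt_inter ((F.triv p).open_baseSet.mem_nhds hpd)).1 (key p ⟨hp, hpd⟩)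

theorem IsSmoothHomOn.id : IsSmoothHomOn E E U (fun p => ContinuousLinearMap.id ℂ (E.Fiber p)) := by
  intro b c
  refine ((E.smooth_coordChange (E.triv b) (E.triv c)).mono inter_subset_right).congr ?_
  rintro p ⟨-, hp⟩
  ext1 w
  rw [ContinuousLinearEquiv.coe_coe, Trivialization.coordChangeL_apply _ _ hp]
  change (E.triv c).continuousLinearMapAt ℂ p ((E.triv b).symmL ℂ p w) = _
  rw [Trivialization.continuousLinearMapAt_apply, Trivialization.coe_linearMapAt_of_mem _ hp.2,
    Trivialization.symmL_apply _ hp.1]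

/-- The Gram matrix of the Hermitian metric in a local trivialization. -/
def gram (E : HermitianBundle.{u, v} X) (b p : X) : ModelFiber E.rank →L[ℂ] ModelFiber E.rank :=
  ContinuousLinearMap.adjoint ((E.triv b).symmL ℂ p) ∘L (E.triv b).symmL ℂ p

theorem gram_smooth (b : X) :
    ContMDiffOn 𝓘(ℝ, ℂ) 𝓘(ℝ, ModelFiber E.rank →L[ℂ] ModelFiber E.rank) ∞
      (fun p => gram E b p) (E.triv b).baseSet := by
  let e := EuclideanSpace.basisFun (Fin E.rank) ℂ
  let K : Fin E.rank → Fin E.rank → (ModelFiber E.rank →L[ℂ] ModelFiber E.rank) :=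
    fun i j => (innerSL ℂ (e j)).smulRight (e i)
  have hsm : ContMDiffOn 𝓘(ℝ, ℂ) 𝓘(ℝ, ModelFiber E.rank →L[ℂ] ModelFiber E.rank) ∞
      (fun p => ∑ i, ∑ j, (inner ℂ ((E.triv b).symm p (e i)) ((E.triv b).symm p (e j)) : ℂ) •
        K i j) (E.triv b).baseSet := by
    refine contMDiffOn_finsetSum fun i _ => contMDiffOn_finsetSum fun j _ => ?_
    have h : ContDiff ℝ ∞ (fun q : ℂ => q • K i j) := contDiff_id.smul contDiff_const
    exact h.contMDiff.comp_contMDiffOn (E.smooth_metric (E.triv b) (e i) (e j))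
  refine hsm.congr fun p hp => ?_
  ext1 w
  rw [← e.sum_repr' (gram E b p w)]
  simp only [sum_apply]
  refine Finset.sum_congr rfl fun i _ => ?_
  have hw : gram E b p w = ∑ j, inner ℂ (e j) w • gram E b p (e j) := by
    conv_lhs => rw [← e.sum_repr' w]
    simp
  rw [hw, inner_sum, Finset.sum_smul]
  refine Finset.sum_congr rfl fun j _ => ?_
  have h2 : inner ℂ (e i) (gram E b p (e j)) =
      (inner ℂ ((E.triv b).symm p (e i)) ((E.triv b).symm p (e j)) : ℂ) := by
    change inner ℂ (e i) (ContinuousLinearMap.adjoint ((E.triv b).symmL ℂ p)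
      ((E.triv b).symmL ℂ p (e j))) = _
    rw [ContinuousLinearMap.adjoint_inner_right, Trivialization.symmL_apply _ hp,
      Trivialization.symmL_apply _ hp]
  rw [inner_smul_right, h2]
  simp [K, smul_smul, mul_comm]

theorem symm_comp_mapAt (b p : X) (hp : p ∈ (E.triv b).baseSet) :
    (E.triv b).symmL ℂ p ∘L (E.triv b).continuousLinearMapAt ℂ p =
      ContinuousLinearMap.id ℂ _ := by
  ext1 w
  exact Trivialization.symmL_continuousLinearMapAt (R := ℂ) (E.triv b) hp w

theorem mapAt_comp_symm (b p : X) (hp : p ∈ (E.triv b).baseSet) :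
    (E.triv b).continuousLinearMapAt ℂ p ∘L (E.triv b).symmL ℂ p =
      ContinuousLinearMap.id ℂ _ := by
  ext1 w
  exact Trivialization.continuousLinearMapAt_symmL (R := ℂ) (E.triv b) hp w

/-- The Gram matrix as a unit. -/
def gramUnit (E : HermitianBundle.{u, v} X) (b p : X) (hp : p ∈ (E.triv b).baseSet) :
    (ModelFiber E.rank →L[ℂ] ModelFiber E.rank)ˣ where
  val := gram E b p
  inv := (E.triv b).continuousLinearMapAt ℂ p ∘L
    ContinuousLinearMap.adjoint ((E.triv b).continuousLinearMapAt ℂ p)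
  val_inv := by
    change (ContinuousLinearMap.adjoint ((E.triv b).symmL ℂ p) ∘L (E.triv b).symmL ℂ p) ∘L
      ((E.triv b).continuousLinearMapAt ℂ p ∘L
        ContinuousLinearMap.adjoint ((E.triv b).continuousLinearMapAt ℂ p)) = _
    rw [ContinuousLinearMap.comp_assoc, ← ContinuousLinearMap.comp_assoc ((E.triv b).symmL ℂ p),
      symm_comp_mapAt b p hp, ContinuousLinearMap.id_comp, ← ContinuousLinearMap.adjoint_comp,
      mapAt_comp_symm b p hp]
    exact ContinuousLinearMap.adjoint_id
  inv_val := by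
    change ((E.triv b).continuousLinearMapAt ℂ p ∘L
        ContinuousLinearMap.adjoint ((E.triv b).continuousLinearMapAt ℂ p)) ∘L
      (ContinuousLinearMap.adjoint ((E.triv b).symmL ℂ p) ∘L (E.triv b).symmL ℂ p) = _
    rw [ContinuousLinearMap.comp_assoc, ← ContinuousLinearMap.comp_assoc
      (ContinuousLinearMap.adjoint ((E.triv b).continuousLinearMapAt ℂ p)),
      ← ContinuousLinearMap.adjoint_comp, symm_comp_mapAt b p hp, ContinuousLinearMap.adjoint_id,
      ContinuousLinearMap.id_comp, mapAt_comp_symm b p hp]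
    rfl

theorem gramInv_smooth (b : X) :
    ContMDiffOn 𝓘(ℝ, ℂ) 𝓘(ℝ, ModelFiber E.rank →L[ℂ] ModelFiber E.rank) ∞
      (fun p => Ring.inverse (gram E b p)) (E.triv b).baseSet := by
  intro p hp
  exact (contDiffAt_ringInverse ℝ (gramUnit E b p hp)).contMDiffAt.comp_contMDiffWithinAt p
    (gram_smooth b p hp)

theorem localRep_adjoint (b c p : X) (hb : p ∈ (E.triv b).baseSet) (hc : p ∈ (F.triv c).baseSet)
    (A : E.Fiber p →L[ℂ] F.Fiber p) :
    localRep F E c b p (ContinuousLinearMap.adjoint A) =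
      Ring.inverse (gram E b p) ∘L
        (ContinuousLinearMap.adjoint (localRep E F b c p A) ∘L gram F c p) := by
  have h1 : Ring.inverse (gram E b p) = (E.triv b).continuousLinearMapAt ℂ p ∘L
      ContinuousLinearMap.adjoint ((E.triv b).continuousLinearMapAt ℂ p) :=
    Ring.inverse_unit (gramUnit E b p hb)
  have h2 : localRep E F b c p A =
    (F.triv c).continuousLinearMapAt ℂ p ∘L (A ∘L (E.triv b).symmL ℂ p) := rfl
  have h3 : localRep F E c b p (ContinuousLinearMap.adjoint A) =
    (E.triv b).continuousLinearMapAt ℂ p ∘L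
      (ContinuousLinearMap.adjoint A ∘L (F.triv c).symmL ℂ p) := rfl
  have h4 : ContinuousLinearMap.adjoint ((F.triv c).continuousLinearMapAt ℂ p) ∘L
      ContinuousLinearMap.adjoint ((F.triv c).symmL ℂ p) = ContinuousLinearMap.id ℂ _ := by
    rw [← ContinuousLinearMap.adjoint_comp, symm_comp_mapAt c p hc,
      ContinuousLinearMap.adjoint_id]
  have h5 : ContinuousLinearMap.adjoint ((E.triv b).continuousLinearMapAt ℂ p) ∘L
      ContinuousLinearMap.adjoint ((E.triv b).symmL ℂ p) = ContinuousLinearMap.id ℂ _ := by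
    rw [← ContinuousLinearMap.adjoint_comp, symm_comp_mapAt b p hb,
      ContinuousLinearMap.adjoint_id]
  rw [h1, h2, h3, ContinuousLinearMap.adjoint_comp, ContinuousLinearMap.adjoint_comp]
  ext1 w
  have h4' := fun w => congrArg (fun L => L w) h4
  have h5' := fun w => congrArg (fun L => L w) h5
  simp only [ContinuousLinearMap.comp_apply, ContinuousLinearMap.id_apply] at h4' h5'
  simp only [gram, ContinuousLinearMap.comp_apply, h4', h5']

theorem contMDiffOn_clmAdjoint {r s : ℕ} {S : Set X}
    {A : X → (ModelFiber r →L[ℂ] ModelFiber s)}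
    (hA : ContMDiffOn 𝓘(ℝ, ℂ) 𝓘(ℝ, ModelFiber r →L[ℂ] ModelFiber s) ∞ A S) :
    ContMDiffOn 𝓘(ℝ, ℂ) 𝓘(ℝ, ModelFiber s →L[ℂ] ModelFiber r) ∞
      (fun p => ContinuousLinearMap.adjoint (A p)) S := by
  have h : IsBoundedLinearMap ℝ (fun B : ModelFiber r →L[ℂ] ModelFiber s =>
      ContinuousLinearMap.adjoint B) :=
    { map_add := fun B C => map_add _ B C
      map_smul := fun k B => by
        ext1 w
        refine ext_inner_left ℂ fun t => ?_
        simp only [ContinuousLinearMap.adjoint_inner_right, smul_apply]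
        rw [RCLike.real_smul_eq_coe_smul (K := ℂ) k (B t), RCLike.real_smul_eq_coe_smul (K := ℂ) k
            (ContinuousLinearMap.adjoint B w), inner_smul_left, inner_smul_right,
            ContinuousLinearMap.adjoint_inner_right, RCLike.conj_ofReal]
      bound := ⟨1, one_pos, fun B => by rw [one_mul, LinearIsometryEquiv.norm_map]⟩ }
  exact h.contDiff.contMDiff.comp_contMDiffOn hA

theorem IsSmoothHomOn.adjoint {x : ∀ p, E.Fiber p →L[ℂ] F.Fiber p}
    (hx : IsSmoothHomOn E F U x) :
    IsSmoothHomOn F E U (fun p => ContinuousLinearMap.adjoint (x p)) := by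
  intro c b
  refine ContMDiffOn.congr ?_ (fun p hp => localRep_adjoint b c p hp.2.2 hp.2.1 (x p))
  refine contMDiffOn_clmComp ((gramInv_smooth b).mono fun p hp => hp.2.2)
    (contMDiffOn_clmComp (contMDiffOn_clmAdjoint ((hx b c).mono ?_))
      ((gram_smooth c).mono fun p hp => hp.2.1))
  rintro p ⟨h1, h2, h3⟩
  exact ⟨h1, h3, h2⟩

theorem contMDiffOn_clmExp {r : ℕ} {S : Set X}
    {A : X → (ModelFiber r →L[ℂ] ModelFiber r)}
    (hA : ContMDiffOn 𝓘(ℝ, ℂ) 𝓘(ℝ, ModelFiber r →L[ℂ] ModelFiber r) ∞ A S) :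
    ContMDiffOn 𝓘(ℝ, ℂ) 𝓘(ℝ, ModelFiber r →L[ℂ] ModelFiber r) ∞
      (fun p => NormedSpace.exp (A p)) S := by
  have h : ContDiff ℝ ∞ (fun B : ModelFiber r →L[ℂ] ModelFiber r => NormedSpace.exp B) :=
    contDiff_iff_contDiffAt.2 fun B => (NormedSpace.exp_analytic (𝕂 := ℝ) B).contDiffAt
  exact h.contMDiff.comp_contMDiffOn hA

theorem localRep_exp (b p : X) (hb : p ∈ (E.triv b).baseSet) (A : E.Fiber p →L[ℂ] E.Fiber p) :
    localRep E E b b p (NormedSpace.exp A) = NormedSpace.exp (localRep E E b b p A) := by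
  let f : (E.Fiber p →L[ℂ] E.Fiber p) →+* (ModelFiber E.rank →L[ℂ] ModelFiber E.rank) :=
    { toFun := localRep E E b b p
      map_one' := by
        change (E.triv b).continuousLinearMapAt ℂ p ∘L
          (ContinuousLinearMap.id ℂ _ ∘L (E.triv b).symmL ℂ p) = _
        rw [ContinuousLinearMap.id_comp, mapAt_comp_symm b p hb]; rfl
      map_mul' := fun B C => localRep_comp b b b p hb B C
      map_zero' := by ext w; simp [localRep, ContinuousLinearMap.inCoordinates]
      map_add' := localRep_add b b p }
  have hf : Continuous f := by
    change Continuous fun A : E.Fiber p →L[ℂ] E.Fiber p =>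
      (E.triv b).continuousLinearMapAt ℂ p ∘L (A ∘L (E.triv b).symmL ℂ p)
    fun_prop
  let _ : NormedAlgebra ℚ (E.Fiber p →L[ℂ] E.Fiber p) := NormedAlgebra.restrictScalars ℚ ℂ _
  exact NormedSpace.map_exp f hf A

theorem IsSmoothHomOn.exp {x : ∀ p, E.Fiber p →L[ℂ] E.Fiber p}
    (hx : IsSmoothHomOn E E U x) : IsSmoothHomOn E E U (fun p => NormedSpace.exp (x p)) := by
  intro b c
  have h1 := (hx b b).mono
    (show U ∩ ((E.triv b).baseSet ∩ (E.triv c).baseSet) ⊆ U ∩ _ from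
      fun p hp => ⟨hp.1, hp.2.1, hp.2.1⟩)
  refine (contMDiffOn_clmComp (IsSmoothHomOn.id (U := U) b c) (contMDiffOn_clmExp h1)).congr ?_
  intro p hp
  rw [← localRep_exp b p hp.2.1]
  exact localRep_comp b b c p hp.2.1 (ContinuousLinearMap.id ℂ _) _

end smooth

/-! ### Sections of `Hom(E, F)` and `Hom(E, F)`-valued two-forms -/

/-- `Ω⁰(X, Hom(E, F))`: smooth global sections of `Hom(E, F)`. -/
def HomSection (E F : HermitianBundle.{u, v} X) :
    Submodule ℂ (∀ p, E.Fiber p →L[ℂ] F.Fiber p) where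
  carrier := {x | IsSmoothHomOn E F univ x}
  add_mem' := fun hx hy => hx.add hy
  zero_mem' := IsSmoothHomOn.zero
  smul_mem' := fun _ _ hx => IsSmoothHomOn.smul contMDiffOn_const hx

instance (E F : HermitianBundle.{u, v} X) : Module ℝ (HomSection E F) := Module.complexToReal _

variable (X) in
/-- The real tangent space of the surface. -/
abbrev TangentPlane (p : X) : Type := TangentSpace 𝓘(ℝ, ℂ) p

/-- The frame `(∂/∂s, ∂/∂t)` at `p` of the holomorphic coordinate `s + i t` given by the preferred
chart around `c`. -/
def coordFrame (c p : X) : Fin 2 → TangentPlane X p :=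
  ![(mfderiv 𝓘(ℝ, ℂ) 𝓘(ℝ, ℂ) (chartAt ℂ c) p).inverse (1 : ℂ),
    (mfderiv 𝓘(ℝ, ℂ) 𝓘(ℝ, ℂ) (chartAt ℂ c) p).inverse Complex.I]

/-- `Ω²(X, Hom(E, F)) = Ω^{1,1}(X, Hom(E, F)) = Ω^{0,1}(X, Hom(E, F) ⊗ K)`: smooth `Hom(E, F)`-valued
two-forms on the Riemann surface `X` (every complex two-form on a Riemann surface is of type
`(1,1)`). Smoothness means that the coefficient of `ds ∧ dt` in every chart is smooth. -/
def HomTwoForm (E F : HermitianBundle.{u, v} X) :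
    Submodule ℂ (∀ p, TangentPlane X p [⋀^Fin 2]→ₗ[ℝ] (E.Fiber p →L[ℂ] F.Fiber p)) where
  carrier := {y | ∀ c : X, IsSmoothHomOn E F (chartAt ℂ c).source (fun p => y p (coordFrame c p))}
  add_mem' := fun hx hy c => (hx c).add (hy c)
  zero_mem' := fun _ => IsSmoothHomOn.zero
  smul_mem' := fun _ _ hx c => IsSmoothHomOn.smul contMDiffOn_const (hx c)

variable (X) in
/-- The area form of a Hermitian (Kähler) metric on the Riemann surface `X`: a smooth real two-form
that is positive for the complex orientation. -/
structure AreaForm where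
  form : ∀ p : X, TangentPlane X p [⋀^Fin 2]→ₗ[ℝ] ℝ
  smooth : ∀ c : X, ContMDiffOn 𝓘(ℝ, ℂ) 𝓘(ℝ, ℝ) ∞ (fun p => form p (coordFrame c p))
    (chartAt ℂ c).source
  pos : ∀ c : X, ∀ p ∈ (chartAt ℂ c).source, 0 < form p (coordFrame c p)

section operations

variable {E F G : HermitianBundle.{u, v} X}

/-- Composition of sections. -/
def HomSection.comp (y : HomSection F G) (x : HomSection E F) : HomSection E G :=
  ⟨fun p => y.1 p ∘L x.1 p, IsSmoothHomOn.comp y.2 x.2⟩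

/-- The Hermitian adjoint `x^*` of a section. -/
def HomSection.adj (x : HomSection E F) : HomSection F E :=
  ⟨fun p => ContinuousLinearMap.adjoint (x.1 p), IsSmoothHomOn.adjoint x.2⟩

/-- The product `x y` of a section `x` of `Hom(F, G)` and a two-form `y` with values in
`Hom(E, F)`. -/
def HomTwoForm.compLeft (x : HomSection F G) (y : HomTwoForm E F) : HomTwoForm E G :=
  ⟨fun p => LinearMap.compAlternatingMap
      { toFun := fun A : E.Fiber p →L[ℂ] F.Fiber p => x.1 p ∘L A
        map_add' := fun A B => ContinuousLinearMap.comp_add _ A B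
        map_smul' := fun k A => by ext w; simp } (y.1 p),
    fun c => IsSmoothHomOn.comp (IsSmoothHomOn.mono (subset_univ _) x.2) (y.2 c)⟩

/-- The product `y x` of a two-form `y` with values in `Hom(F, G)` and a section `x` of
`Hom(E, F)`. -/
def HomTwoForm.compRight (y : HomTwoForm F G) (x : HomSection E F) : HomTwoForm E G :=
  ⟨fun p => LinearMap.compAlternatingMap
      { toFun := fun A : F.Fiber p →L[ℂ] G.Fiber p => A ∘L x.1 p
        map_add' := fun A B => ContinuousLinearMap.add_comp A B _
        map_smul' := fun k A => by ext w; simp } (y.1 p),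
    fun c => IsSmoothHomOn.comp (y.2 c) (IsSmoothHomOn.mono (subset_univ _) x.2)⟩

/-- The trace of a section of `End(E)`. -/
def HomSection.trace (x : HomSection E E) (p : X) : ℂ :=
  LinearMap.trace ℂ (E.Fiber p) (x.1 p : E.Fiber p →ₗ[ℂ] E.Fiber p)

/-- The trace of an `End(E)`-valued two-form, a complex-valued two-form. -/
def HomTwoForm.trace (y : HomTwoForm E E) (p : X) : TangentPlane X p [⋀^Fin 2]→ₗ[ℝ] ℂ :=
  LinearMap.compAlternatingMap
    { toFun := fun A : E.Fiber p →L[ℂ] E.Fiber p =>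
        LinearMap.trace ℂ (E.Fiber p) (A : E.Fiber p →ₗ[ℂ] E.Fiber p)
      map_add' := fun A B => by simp
      map_smul' := fun k A => by
        have : ((k • A : E.Fiber p →L[ℂ] E.Fiber p) : E.Fiber p →ₗ[ℂ] E.Fiber p) =
          (k : ℂ) • (A : E.Fiber p →ₗ[ℂ] E.Fiber p) := by ext w; simp
        rw [this, map_smul]; simp } (y.1 p)

theorem alternating_plane {N : Type*} [AddCommGroup N] [Module ℝ N]
    (γ : ℂ [⋀^Fin 2]→ₗ[ℝ] N) (a : Fin 2 → ℂ) :
    γ a = ((a 0).re * (a 1).im - (a 0).im * (a 1).re) • γ ![1, Complex.I] := by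
  have hadd : ∀ x y z : ℂ, γ ![x + y, z] = γ ![x, z] + γ ![y, z] :=
    fun x y z => γ.map_vecCons_add ![z] x y
  have hsm : ∀ (k : ℝ) (x z : ℂ), γ ![k • x, z] = k • γ ![x, z] :=
    fun k x z => γ.map_vecCons_smul ![z] k x
  have hsw : ∀ x z : ℂ, γ ![x, z] = - γ ![z, x] := by
    intro x z
    rw [← γ.map_swap ![z, x] (show (0 : Fin 2) ≠ 1 by decide)]
    congr 1
    ext i
    fin_cases i <;> rfl
  have hself : ∀ x : ℂ, γ ![x, x] = 0 := fun x =>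
    γ.map_eq_zero_of_eq ![x, x] (i := 0) (j := 1) rfl (by decide)
  have hz : ∀ z : ℂ, z = z.re • (1 : ℂ) + z.im • Complex.I := fun z => by
    simp [Complex.re_add_im]
  have ha : a = ![a 0, a 1] := by ext i; fin_cases i <;> rfl
  have h1 : ∀ z : ℂ, γ ![(1 : ℂ), z] = z.im • γ ![1, Complex.I] := by
    intro z
    rw [hsw]
    conv_lhs => rw [hz z]
    rw [hadd, hsm, hsm, hself, hsw Complex.I]
    simp
  have hI : ∀ z : ℂ, γ ![Complex.I, z] = - (z.re • γ ![1, Complex.I]) := by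
    intro z
    rw [hsw]
    conv_lhs => rw [hz z]
    rw [hadd, hsm, hsm, hself]
    simp
  conv_lhs => rw [ha, hz (a 0)]
  rw [hadd, hsm, hsm, h1, hI]
  module

theorem alternating_ratio {N : Type*} [AddCommGroup N] [Module ℝ N]
    (β : ℂ [⋀^Fin 2]→ₗ[ℝ] ℝ) (α : ℂ [⋀^Fin 2]→ₗ[ℝ] N) (u w : Fin 2 → ℂ) :
    β u • α w = β w • α u := by
  have hβ := fun a => alternating_plane (γ := β) a
  have hα := fun a => alternating_plane (γ := α) a
  rw [hα w, hα u, hβ w, hβ u]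
  module

/-- The function `⋆y` with values in `Hom(E, F)` such that `y = (⋆y) σ`, for the area form `σ`. -/
def AreaForm.star (σ : AreaForm X) (y : HomTwoForm E F) : HomSection E F :=
  ⟨fun p => (((σ.form p (coordFrame p p))⁻¹ : ℝ) : ℂ) • y.1 p (coordFrame p p), by
    intro b c
    rintro p ⟨-, hp⟩
    have hsm : IsSmoothHomOn E F (chartAt ℂ p).source
        (fun q => (((σ.form q (coordFrame p q))⁻¹ : ℝ) : ℂ) • y.1 q (coordFrame p q)) := by
      refine IsSmoothHomOn.smul ?_ (y.2 p)
      intro q hq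
      have h1 : ContDiffAt ℝ ∞ (fun t : ℝ => ((t⁻¹ : ℝ) : ℂ)) (σ.form q (coordFrame p q)) :=
        Complex.ofRealCLM.contDiff.contDiffAt.comp _ (contDiffAt_inv ℝ (σ.pos p q hq).ne')
      exact h1.contMDiffAt.comp_contMDiffWithinAt q (σ.smooth p q hq)
    have heq : ∀ q ∈ (chartAt ℂ p).source,
        (((σ.form q (coordFrame q q))⁻¹ : ℝ) : ℂ) • y.1 q (coordFrame q q) =
          (((σ.form q (coordFrame p q))⁻¹ : ℝ) : ℂ) • y.1 q (coordFrame p q) := by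
      intro q hq
      have h1 := (σ.pos p q hq).ne'
      have h2 := (σ.pos q q (mem_chart_source ℂ q)).ne'
      have h3 := alternating_ratio (σ.form q) (y.1 q) (coordFrame q q) (coordFrame p q)
      rw [Complex.coe_smul, Complex.coe_smul, inv_smul_eq_iff₀ h2, smul_comm,
        eq_inv_smul_iff₀ h1]
      exact h3.symm
    have hpsrc : (chartAt ℂ p).source ∈ nhds p :=
      (chartAt ℂ p).open_source.mem_nhds (mem_chart_source ℂ p)
    refine (contMDiffWithinAt_inter hpsrc).1 ?_
    have := ((hsm b c).congr (f₁ := fun q => localRep E F b c q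
      ((((σ.form q (coordFrame q q))⁻¹ : ℝ) : ℂ) • y.1 q (coordFrame q q)))
      (fun q hq => by rw [heq q hq.1])) p ⟨mem_chart_source ℂ p, hp⟩
    exact this.mono (fun q hq => ⟨hq.2, hq.1.2⟩)⟩

/-- The product `f σ` of a complex function and the area form. -/
def AreaForm.smulForm (σ : AreaForm X) (f : X → ℂ) (p : X) : TangentPlane X p [⋀^Fin 2]→ₗ[ℝ] ℂ :=
  LinearMap.compAlternatingMap (LinearMap.toSpanSingleton ℝ ℂ (f p)) (σ.form p)

end operations

/-! ### Integration -/

/-- A complex curve is a smooth real surface. -/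
theorem isManifold_real (X : Type u) [TopologicalSpace X] [ChartedSpace ℂ X]
    [IsManifold 𝓘(ℂ) ω X] : IsManifold 𝓘(ℝ, ℂ) ∞ X := by
  refine isManifold_of_contDiffOn _ _ _ fun e e' he he' => ?_
  have h := (contDiffGroupoid ω 𝓘(ℂ)).compatible he he'
  rw [contDiffGroupoid, mem_groupoid_of_pregroupoid] at h
  exact (h.1.restrict_scalars ℝ).of_le le_top

section integration

variable (X) [CompactSpace X] [T2Space X] [IsManifold 𝓘(ℂ) ω X]

theorem exists_partition : ∃ f : SmoothPartitionOfUnity X 𝓘(ℝ, ℂ) X univ,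
    f.IsSubordinate (fun c => (chartAt ℂ c).source) :=
  have := isManifold_real X
  SmoothPartitionOfUnity.exists_isSubordinate_chartAt_source 𝓘(ℝ, ℂ) X

/-- A smooth partition of unity subordinate to the preferred charts. -/
def partition : SmoothPartitionOfUnity X 𝓘(ℝ, ℂ) X univ := (exists_partition X).choose

variable {X}

/-- The integral `∫_X α` of a complex-valued two-form over the compact Riemann surface `X` with its
complex orientation: `∑_c ∫ ρ_c α` for a partition of unity `ρ` subordinate to the charts, each
summand being computed in the holomorphic coordinate `z = s + i t` of the chart around `c` as
the Lebesgue integral of the coefficient of `ds ∧ dt`. -/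
def integral (α : ∀ p, TangentPlane X p [⋀^Fin 2]→ₗ[ℝ] ℂ) : ℂ :=
  ∑ᶠ c : X, ∫ z in (chartAt ℂ c).target,
    ((partition X c ((chartAt ℂ c).symm z) : ℝ) : ℂ) *
      α ((chartAt ℂ c).symm z) (coordFrame c ((chartAt ℂ c).symm z))

end integration

/-! ### The gauge group and its Lie algebra -/

/-- The group `Aut(E)` of smooth unitary automorphisms of `E`. -/
def gaugeSubgroup (E : HermitianBundle.{u, v} X) :
    Subgroup (∀ p, unitary (E.Fiber p →L[ℂ] E.Fiber p)) where
  carrier := {g | IsSmoothHomOn E E univ (fun p => (g p : E.Fiber p →L[ℂ] E.Fiber p))}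
  mul_mem' := fun hg hh => IsSmoothHomOn.comp hg hh
  one_mem' := IsSmoothHomOn.id
  inv_mem' := fun hg => IsSmoothHomOn.adjoint hg

/-- The Lie algebra of `Aut(E)`: smooth skew-adjoint endomorphisms of `E`. -/
def gaugeLie (E : HermitianBundle.{u, v} X) : Submodule ℝ (HomSection E E) where
  carrier := {θ | ∀ p, star (θ.1 p) = -θ.1 p}
  add_mem' := fun {a b} ha hb p => by
    change star (a.1 p + b.1 p) = -(a.1 p + b.1 p)
    rw [star_add, ha p, hb p]; abel
  zero_mem' := fun p => by
    change star (0 : E.Fiber p →L[ℂ] E.Fiber p) = -0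
    simp
  smul_mem' := fun k a ha p => by
    change star ((k : ℂ) • a.1 p) = -((k : ℂ) • a.1 p)
    rw [star_smul, ha p]; simp

/-- A gauge transformation as an endomorphism of the bundle. -/
def gaugeHom {E : HermitianBundle.{u, v} X} (g : gaugeSubgroup E) : HomSection E E :=
  ⟨fun p => (g.1 p : E.Fiber p →L[ℂ] E.Fiber p), g.2⟩

/-- The exponential map of the gauge group. -/
def gaugeExp {E : HermitianBundle.{u, v} X} (θ : gaugeLie E) : gaugeSubgroup E :=
  ⟨fun p => ⟨NormedSpace.exp (θ.1.1 p), by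
      let _ : NormedAlgebra ℚ (E.Fiber p →L[ℂ] E.Fiber p) := NormedAlgebra.restrictScalars ℚ ℂ _
      exact NormedSpace.exp_mem_unitary_of_mem_skewAdjoint (skewAdjoint.mem_iff.2 (θ.2 p))⟩,
    IsSmoothHomOn.exp θ.1.2⟩

/-- The adjoint action `θ ↦ g θ g⁻¹`. -/
def gaugeAd {E : HermitianBundle.{u, v} X} (g : gaugeSubgroup E) (θ : gaugeLie E) : gaugeLie E :=
  ⟨HomSection.comp (HomSection.comp (gaugeHom g) θ.1) (gaugeHom g⁻¹), fun p => by
    change star ((g.1 p : E.Fiber p →L[ℂ] E.Fiber p) * θ.1.1 p * star (g.1 p).1) =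
      -((g.1 p : E.Fiber p →L[ℂ] E.Fiber p) * θ.1.1 p * star (g.1 p).1)
    rw [star_mul, star_mul, star_star, θ.2 p]
    simp [mul_assoc]⟩

/-! ### Edge representations of the double quiver -/

section quiver

variable {V : Type*} [Quiver.{w + 1} V]

/-- The space of edge representations of the double of the quiver `V` in the family of bundles `E`:
a smooth section `x_a` of `Hom(E_i, E_j)` for every edge `a : i ⟶ j`, and a `Hom(E_j, E_i)`-valued
`(1,1)`-form `y_a` for the reversed edge. By the pairing `(x, y) ↦ ∫ tr (x y)` this is the (smooth)
cotangent space of `⨁_a Ω⁰(X, Hom(E_i, E_j))`; the form `y_a ∈ Ω^{0,1}(X, Hom(E_j, E_i) ⊗ K)` is a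
Dolbeault representative of the class in `H¹(X, Hom(E_j, E_i) ⊗ K)`. -/
@[ext]
structure EdgeRep (E : V → HermitianBundle.{u, v} X) where
  x : ∀ i j : V, (i ⟶ j) → HomSection (E i) (E j)
  y : ∀ i j : V, (i ⟶ j) → HomTwoForm (E j) (E i)

variable (E : V → HermitianBundle.{u, v} X)

/-- The vector space structure is the componentwise one. -/
def EdgeRep.equiv : EdgeRep E ≃ ((∀ i j : V, (i ⟶ j) → HomSection (E i) (E j)) ×
    (∀ i j : V, (i ⟶ j) → HomTwoForm (E j) (E i))) where
  toFun z := (z.x, z.y)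
  invFun z := ⟨z.1, z.2⟩
  left_inv _ := rfl
  right_inv _ := rfl

instance : AddCommGroup (EdgeRep E) := (EdgeRep.equiv E).addCommGroup

instance : Module ℂ (EdgeRep E) := (EdgeRep.equiv E).module ℂ

/-- The group `𝒢 = ∏_i Aut(E_i)`. -/
def GaugeGroup : Type _ := ∀ i : V, gaugeSubgroup (E i)

instance : Group (GaugeGroup E) := inferInstanceAs (Group (∀ i : V, gaugeSubgroup (E i)))

/-- The Lie algebra `𝔤 = ⨁_i Lie(Aut(E_i))`. -/
def GaugeAlgebra : Type _ := ∀ i : V, gaugeLie (E i)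

instance : AddCommGroup (GaugeAlgebra E) :=
  inferInstanceAs (AddCommGroup (∀ i : V, gaugeLie (E i)))

instance : Module ℝ (GaugeAlgebra E) := inferInstanceAs (Module ℝ (∀ i : V, gaugeLie (E i)))

variable {E} in
/-- The exponential map `𝔤 → 𝒢`. -/
def GaugeAlgebra.exp (θ : GaugeAlgebra E) : GaugeGroup E := fun i => gaugeExp (θ i)

variable {E} in
/-- The adjoint action of `𝒢` on `𝔤`. -/
def GaugeGroup.ad (g : GaugeGroup E) (θ : GaugeAlgebra E) : GaugeAlgebra E :=
  fun i => gaugeAd (g i) (θ i)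

variable {E}

/-- The gauge action `g · (x, y) = (g_{h(a)} x_a g_{t(a)}⁻¹, g_{t(a)} y_a g_{h(a)}⁻¹)`. -/
instance : MulAction (GaugeGroup E) (EdgeRep E) where
  smul g z :=
    ⟨fun i j a => HomSection.comp (HomSection.comp (gaugeHom (g j)) (z.x i j a))
        (gaugeHom (g i)⁻¹),
      fun i j a => HomTwoForm.compRight (HomTwoForm.compLeft (gaugeHom (g i)) (z.y i j a))
        (gaugeHom (g j)⁻¹)⟩
  one_smul z := by
    refine EdgeRep.ext ?_ ?_
    · funext i j a
      refine Subtype.ext (funext fun p => ?_)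
      change (1 : (E j).Fiber p →L[ℂ] (E j).Fiber p) ∘L (z.x i j a).1 p ∘L
        ((1 : gaugeSubgroup (E i))⁻¹.1 p).1 = _
      rw [inv_one]
      rfl
    · funext i j a
      refine Subtype.ext (funext fun p => AlternatingMap.ext fun t => ?_)
      change (1 : (E i).Fiber p →L[ℂ] (E i).Fiber p) ∘L (z.y i j a).1 p t ∘L
        ((1 : gaugeSubgroup (E j))⁻¹.1 p).1 = _
      rw [inv_one]
      rfl
  mul_smul g h z := by
    refine EdgeRep.ext ?_ ?_
    · funext i j a
      refine Subtype.ext (funext fun p => ?_)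
      change ((g j).1 p).1 ∘L ((h j).1 p).1 ∘L (z.x i j a).1 p ∘L ((g i * h i)⁻¹.1 p).1 = _
      rw [mul_inv_rev]
      rfl
    · funext i j a
      refine Subtype.ext (funext fun p => AlternatingMap.ext fun t => ?_)
      change ((g i).1 p).1 ∘L ((h i).1 p).1 ∘L (z.y i j a).1 p t ∘L ((g j * h j)⁻¹.1 p).1 = _
      rw [mul_inv_rev]
      rfl

/-- The infinitesimal action
`θ · (x, y) = (θ_{h(a)} x_a - x_a θ_{t(a)}, θ_{t(a)} y_a - y_a θ_{h(a)})`. -/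
def infAction (θ : GaugeAlgebra E) (z : EdgeRep E) : EdgeRep E :=
  ⟨fun i j a => HomSection.comp (θ j).1 (z.x i j a) - HomSection.comp (z.x i j a) (θ i).1,
    fun i j a => HomTwoForm.compLeft (θ i).1 (z.y i j a) -
      HomTwoForm.compRight (z.y i j a) (θ j).1⟩

variable [Fintype V] [∀ i j : V, Fintype (i ⟶ j)]

section forms

variable [CompactSpace X] [T2Space X] [IsManifold 𝓘(ℂ) ω X]

/-- The real symplectic form: twice the imaginary part of the `L²` Hermitian inner product
`∑_a ∫_X tr (x_a x'_a^* + y'_a^* y_a)`. The (conjugate-linear) adjoint of a two-form is taken with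
respect to the metrics of the bundles and of `X`; as the area form `σ` has length one, the
endomorphism `y'^* y` is `(⋆y')^* (⋆y)`. -/
def omegaR (σ : AreaForm X) (z z' : EdgeRep E) : ℝ :=
  2 * (∑ i : V, ∑ j : V, ∑ a : i ⟶ j, integral (σ.smulForm (HomSection.trace
    (HomSection.comp (z.x i j a) (HomSection.adj (z'.x i j a)) +
      HomSection.comp (HomSection.adj (σ.star (z'.y i j a))) (σ.star (z.y i j a)))))).im

/-- The complex symplectic form `∑_a ∫_X tr (x_a y'_a - x'_a y_a)`. -/
def omegaC (z z' : EdgeRep E) : ℂ :=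
  ∑ i : V, ∑ j : V, ∑ a : i ⟶ j, integral (HomTwoForm.trace
    (HomTwoForm.compLeft (z.x i j a) (z'.y i j a) -
      HomTwoForm.compLeft (z'.x i j a) (z.y i j a)))

/-- The pairing of a family of (self-adjoint) endomorphisms with the Lie algebra `𝔤`: the value of
`(1/√-1) ∑_i ∫_X tr (θ_i m_i) σ`, which is real for `θ_i` skew-adjoint and `m_i` self-adjoint. -/
def pairR (σ : AreaForm X) (m : ∀ i, HomSection (E i) (E i)) (θ : GaugeAlgebra E) : ℝ :=
  (∑ i : V, integral (σ.smulForm (HomSection.trace (HomSection.comp (θ i).1 (m i))))).im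

/-- The pairing `∑_i ∫_X tr (θ_i m_i)` of a family of `End(E_i)`-valued two-forms with the Lie
algebra `𝔤`. -/
def pairC (m : ∀ i, HomTwoForm (E i) (E i)) (θ : GaugeAlgebra E) : ℂ :=
  ∑ i : V, integral (HomTwoForm.trace (HomTwoForm.compLeft (θ i).1 (m i)))

end forms

/-- The real moment map: its component at the vertex `i` is
`∑_{h(a) = i} (x_a x_a^* - y_a^* y_a) - ∑_{t(a) = i} (x_a^* x_a - y_a y_a^*)`. -/
def muR (σ : AreaForm X) (z : EdgeRep E) (i : V) : HomSection (E i) (E i) :=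
  (∑ j : V, ∑ a : j ⟶ i,
    (HomSection.comp (z.x j i a) (HomSection.adj (z.x j i a)) -
      HomSection.comp (HomSection.adj (σ.star (z.y j i a))) (σ.star (z.y j i a)))) -
  ∑ j : V, ∑ a : i ⟶ j,
    (HomSection.comp (HomSection.adj (z.x i j a)) (z.x i j a) -
      HomSection.comp (σ.star (z.y i j a)) (HomSection.adj (σ.star (z.y i j a))))

/-- The complex moment map: its component at the vertex `i` is
`∑_{h(a) = i} x_a y_a - ∑_{t(a) = i} y_a x_a`. -/
def muC (z : EdgeRep E) (i : V) : HomTwoForm (E i) (E i) :=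
  (∑ j : V, ∑ a : j ⟶ i, HomTwoForm.compLeft (z.x j i a) (z.y j i a)) -
  ∑ j : V, ∑ a : i ⟶ j, HomTwoForm.compRight (z.y i j a) (z.x i j a)

end quiver

/-! ### Hamiltonian actions -/

/-- A linear action of a group `G` with Lie algebra `𝔤` on a `𝕜`-vector space `W` is Hamiltonian for
the constant (hence closed) symplectic form `Ω`, with moment map `μ : W → 𝔤^*`. Here `ξ θ` is the
vector field generated by `θ ∈ 𝔤` and `Ad` the adjoint action. The form is only required to be
weakly non-degenerate, as `W` may have infinite dimension, and the differential
`d⟨μ, θ⟩_z (w) = Ω (ξ_θ (z), w)` is computed as the derivative at `z` in every direction `w`. -/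
structure IsHamiltonianAction (𝕜 : Type*) [RCLike 𝕜] {G 𝔤 W : Type*} [Group G] [AddCommGroup 𝔤]
    [Module ℝ 𝔤] [AddCommGroup W] [Module 𝕜 W] [MulAction G W]
    (Ad : G → 𝔤 → 𝔤) (ξ : 𝔤 → W → W) (Ω : W → W → 𝕜) (μ : W → 𝔤 → 𝕜) : Prop where
  form_add : ∀ z z' w, Ω (z + z') w = Ω z w + Ω z' w
  form_smul : ∀ (k : 𝕜) (z w), Ω (k • z) w = k * Ω z w
  form_skew : ∀ z w, Ω z w = - Ω w z
  form_nondegenerate : ∀ z, (∀ w, Ω z w = 0) → z = 0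
  form_invariant : ∀ (g : G) (z w), Ω (g • z) (g • w) = Ω z w
  moment_add : ∀ z θ η, μ z (θ + η) = μ z θ + μ z η
  moment_smul : ∀ (z) (k : ℝ) (θ), μ z (k • θ) = (k : 𝕜) * μ z θ
  moment_deriv : ∀ θ z w, HasLineDerivAt 𝕜 (fun z => μ z θ) (Ω (ξ θ z) w) z w
  moment_equivariant : ∀ (g : G) (z θ), μ (g • z) (Ad g θ) = μ z θ

end QuiverBundle

/-! The area form `σ` vanishes nowhere, and alternating two-forms on a real plane are all
proportional, so `y = (⋆y) σ` identifies two-forms with sections. Everything can then be expressed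
through the single functional `I(x) = ∫ tr(x) σ` on sections of `End(E)`, called `intTrace`. Four
properties of it suffice: it is complex linear; it is cyclic, `I(xy) = I(yx)`; it satisfies `I(x^*)
= conj I(x)`; and `Re I(x x^*)` is nonnegative and vanishes only for `x = 0`. The last property is
the analytic one: a continuous nonnegative function whose integral against `σ` is zero must vanish.

The rest is algebra of words in `x`, `⋆y`, adjoints and `θ`, one edge at a time. Regrouping the
vertex sums in the moment maps by edges expresses both pairings as sums of edge terms (`pairR_muR`,
`pairC_muC`). Each edge term is quadratic in `(x, y)`, so along a line it is a polynomial `f(z) + tD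
+ t²Q`, and the derivative is the coefficient `D`. Cyclicity identifies `D` with the symplectic
form. In the real case there are two cross terms, `θ x x'^*` and `θ x' x^*`; skew-adjointness of `θ`
makes the imaginary parts of their integrals equal, which accounts for the factor 2 in `omegaR`
(`edgePairR_add_smul`).

Non-degeneracy follows by choosing the second argument so that the form returns the squared `L²`
norm of `z`: `-i z` for the real form, `(-(⋆y)^*, x^* σ)` for the complex one. Invariance and
equivariance hold because conjugation by gauge transformations respects composition, respects
adjoints by unitarity, and leaves `I` unchanged by cyclicity. -/

namespace QuiverBundle

universe u v w

/-! ### Integration of continuous two-forms over a compact surface. -/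

section integration

open MeasureTheory

variable {X : Type u} [TopologicalSpace X] [ChartedSpace ℂ X]

/-- The coefficients of a two-form in all charts are continuous. -/
def IsContinuousForm (α : ∀ p, TangentPlane X p [⋀^Fin 2]→ₗ[ℝ] ℂ) : Prop :=
  ∀ c : X, ContinuousOn (fun p => α p (coordFrame c p)) (chartAt ℂ c).source

variable {α β : ∀ p, TangentPlane X p [⋀^Fin 2]→ₗ[ℝ] ℂ}

theorem IsContinuousForm.comp_symm (hα : IsContinuousForm α) (c : X) :
    ContinuousOn (fun z => α ((chartAt ℂ c).symm z) (coordFrame c ((chartAt ℂ c).symm z)))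
      (chartAt ℂ c).target :=
  (hα c).comp (chartAt ℂ c).continuousOn_symm (chartAt ℂ c).mapsTo_symm

variable [CompactSpace X] [T2Space X] [IsManifold 𝓘(ℂ) ω X]

/-- The summand of `integral` that belongs to the chart around `c`, as a function on `ℂ`. -/
def chartIntegrand (c : X) (α : ∀ p, TangentPlane X p [⋀^Fin 2]→ₗ[ℝ] ℂ) (z : ℂ) : ℂ :=
  ((partition X c ((chartAt ℂ c).symm z) : ℝ) : ℂ) *
    α ((chartAt ℂ c).symm z) (coordFrame c ((chartAt ℂ c).symm z))

theorem tsupport_partition_subset (c : X) :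
    tsupport (partition X c) ⊆ (chartAt ℂ c).source :=
  (exists_partition X).choose_spec c

theorem continuousOn_chartIntegrand (hα : IsContinuousForm α) (c : X) :
    ContinuousOn (chartIntegrand c α) (chartAt ℂ c).target :=
  (Complex.continuous_ofReal.comp_continuousOn
    ((partition X c).contMDiff.continuous.comp_continuousOn (chartAt ℂ c).continuousOn_symm)).mul
    (hα.comp_symm c)

/-- The form may be unbounded near the edge of the chart. The integrand, however, vanishes off the
image of the support of the partition function, which is a compact subset of the target. -/
theorem integrableOn_chartIntegrand (hα : IsContinuousForm α) (c : X) :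
    IntegrableOn (chartIntegrand c α) (chartAt ℂ c).target := by
  have hK : IsCompact (chartAt ℂ c '' tsupport (partition X c)) :=
    (isClosed_tsupport _).isCompact.image_of_continuousOn
      ((chartAt ℂ c).continuousOn.mono (tsupport_partition_subset c))
  have hsub : chartAt ℂ c '' tsupport (partition X c) ⊆ (chartAt ℂ c).target := by
    rintro _ ⟨p, hp, rfl⟩
    exact (chartAt ℂ c).map_source (tsupport_partition_subset c hp)
  refine (((continuousOn_chartIntegrand hα c).mono hsub).integrableOn_compact hK)
    |>.of_forall_sdiff_eq_zero (chartAt ℂ c).open_target.measurableSet ?_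
  rintro z ⟨hz, hzK⟩
  have h0 : partition X c ((chartAt ℂ c).symm z) = 0 := by
    refine image_eq_zero_of_notMem_tsupport fun h => hzK ⟨_, h, (chartAt ℂ c).right_inv hz⟩
  simp [chartIntegrand, h0]

variable (X) in
theorem finite_support_partition : {c : X | Function.support (partition X c) ≠ ∅}.Finite := by
  simpa only [nonempty_iff_ne_empty] using
    (partition X).locallyFinite.finite_nonempty_of_compact

variable (X) in
/-- The finitely many charts that carry the partition of unity. -/
def chartFinset : Finset X := (finite_support_partition X).toFinset

theorem partition_eq_zero {c : X} (hc : c ∉ chartFinset X) (p : X) : partition X c p = 0 := by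
  simp only [chartFinset, Finite.mem_toFinset, mem_ofPred_eq, not_not] at hc
  exact congrFun (Function.support_eq_empty_iff.1 hc) p

/-- Compactness and local finiteness leave only finitely many nonzero partition functions, one fixed
finite set for all forms. This allows termwise arguments in place of `finsum`. -/
theorem integral_eq_sum (α : ∀ p, TangentPlane X p [⋀^Fin 2]→ₗ[ℝ] ℂ) :
    integral α = ∑ c ∈ chartFinset X, ∫ z in (chartAt ℂ c).target, chartIntegrand c α z := by
  refine finsum_eq_sum_of_support_subset _ fun c hc => ?_
  by_contra h
  refine hc ?_
  simp [partition_eq_zero h]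

theorem integral_add (hα : IsContinuousForm α) (hβ : IsContinuousForm β) :
    integral (fun p => α p + β p) = integral α + integral β := by
  simp only [integral_eq_sum, ← Finset.sum_add_distrib]
  refine Finset.sum_congr rfl fun c _ => ?_
  rw [← MeasureTheory.integral_add (integrableOn_chartIntegrand hα c)
    (integrableOn_chartIntegrand hβ c)]
  exact integral_congr_ae (.of_forall fun z => by simp [chartIntegrand, mul_add])

theorem integral_smul (k : ℂ) :
    integral (fun p => k • α p) = k * integral α := by
  simp only [integral_eq_sum, Finset.mul_sum]
  refine Finset.sum_congr rfl fun c _ => ?_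
  rw [← MeasureTheory.integral_const_mul]
  exact integral_congr_ae (.of_forall fun z => by simp [chartIntegrand]; ring)

theorem integral_conj (h : ∀ p w, β p w = (starRingEnd ℂ) (α p w)) :
    integral β = (starRingEnd ℂ) (integral α) := by
  simp only [integral_eq_sum, map_sum]
  refine Finset.sum_congr rfl fun c _ => ?_
  rw [← _root_.integral_conj]
  exact integral_congr_ae (.of_forall fun z => by simp [chartIntegrand, h])

theorem chartIntegrand_smulForm (σ : AreaForm X) (f : X → ℝ) (c : X) (z : ℂ) :
    chartIntegrand c (σ.smulForm fun p => (f p : ℂ)) z =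
      ((partition X c ((chartAt ℂ c).symm z) *
        (σ.form ((chartAt ℂ c).symm z) (coordFrame c ((chartAt ℂ c).symm z)) *
          f ((chartAt ℂ c).symm z)) : ℝ) : ℂ) := by
  simp [chartIntegrand, AreaForm.smulForm]

theorem re_chartIntegrand_nonneg (σ : AreaForm X) {f : X → ℝ} (hf : ∀ p, 0 ≤ f p) (c : X) {z : ℂ}
    (hz : z ∈ (chartAt ℂ c).target) :
    0 ≤ (chartIntegrand c (σ.smulForm fun p => (f p : ℂ)) z).re := by
  rw [chartIntegrand_smulForm, Complex.ofReal_re]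
  exact mul_nonneg ((partition X).nonneg c _)
    (mul_nonneg (σ.pos c _ ((chartAt ℂ c).map_target hz)).le (hf _))

theorem re_setIntegral_chartIntegrand {α : ∀ p, TangentPlane X p [⋀^Fin 2]→ₗ[ℝ] ℂ}
    (hα : IsContinuousForm α) (c : X) :
    (∫ z in (chartAt ℂ c).target, chartIntegrand c α z).re =
      ∫ z in (chartAt ℂ c).target, (chartIntegrand c α z).re :=
  (integral_re (integrableOn_chartIntegrand hα c)).symm

/-- The integral of a nonnegative function against the area form is nonnegative. -/
theorem integral_smulForm_nonneg (σ : AreaForm X) {f : X → ℝ} (hf : ∀ p, 0 ≤ f p)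
    (hc : IsContinuousForm (σ.smulForm fun p => (f p : ℂ))) :
    0 ≤ (integral (σ.smulForm fun p => (f p : ℂ))).re := by
  rw [integral_eq_sum, Complex.re_sum]
  refine Finset.sum_nonneg fun c _ => ?_
  rw [re_setIntegral_chartIntegrand hc]
  exact setIntegral_nonneg (chartAt ℂ c).open_target.measurableSet
    fun z hz => re_chartIntegrand_nonneg σ hf c hz

/-- A nonnegative function with vanishing integral against the area form vanishes. -/
theorem eq_zero_of_integral_smulForm (σ : AreaForm X) {f : X → ℝ} (hf : ∀ p, 0 ≤ f p)
    (hc : IsContinuousForm (σ.smulForm fun p => (f p : ℂ)))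
    (h : (integral (σ.smulForm fun p => (f p : ℂ))).re = 0) (p : X) : f p = 0 := by
  have hmeas : ∀ c : X, MeasurableSet (chartAt ℂ c).target :=
    fun c => (chartAt ℂ c).open_target.measurableSet
  -- A chart whose partition function is positive at `p` detects the value `f p`.
  obtain ⟨c, hcp⟩ := (partition X).exists_pos_of_mem (mem_univ p)
  have hps : p ∈ (chartAt ℂ c).source :=
    tsupport_partition_subset c (subset_tsupport _ hcp.ne')
  have hcF : c ∈ chartFinset X := by
    by_contra hn
    exact hcp.ne' (partition_eq_zero hn p)
  rw [integral_eq_sum, Complex.re_sum, Finset.sum_eq_zero_iff_of_nonneg] at h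
  · have h1 := h c hcF
    rw [re_setIntegral_chartIntegrand hc, setIntegral_eq_zero_iff_of_nonneg_ae] at h1
    -- Vanishing almost everywhere becomes vanishing everywhere: the integrand is continuous on the
    -- open chart target, and Lebesgue measure charges every nonempty open set.
    · have h2 := Measure.eqOn_open_of_ae_eq h1 (chartAt ℂ c).open_target
        (Complex.continuous_re.comp_continuousOn (continuousOn_chartIntegrand hc c))
        continuousOn_const ((chartAt ℂ c).map_source hps)
      simp only [chartIntegrand_smulForm, Complex.ofReal_re, (chartAt ℂ c).left_inv hps,
        Pi.zero_apply] at h2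
      exact ((mul_eq_zero.1 ((mul_eq_zero.1 h2).resolve_left hcp.ne')).resolve_left
        (σ.pos c _ ((chartAt ℂ c).map_target ((chartAt ℂ c).map_source hps))).ne')
    · exact (ae_restrict_iff' (hmeas c)).2
        (.of_forall fun z hz => re_chartIntegrand_nonneg σ hf c hz)
    · exact (integrableOn_chartIntegrand hc c).re
  · intro c _
    rw [re_setIntegral_chartIntegrand hc]
    exact setIntegral_nonneg (hmeas c) fun z hz => re_chartIntegrand_nonneg σ hf c hz

end integration

/-! ### Traces of smooth endomorphisms are continuous. -/

section trace

variable {X : Type u} [TopologicalSpace X] [ChartedSpace ℂ X]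
variable {E F G H : HermitianBundle.{u, v} X}

theorem trace_localRep (b p : X) (hb : p ∈ (E.triv b).baseSet) (A : E.Fiber p →L[ℂ] E.Fiber p) :
    LinearMap.trace ℂ _ (localRep E E b b p A).toLinearMap =
      LinearMap.trace ℂ _ A.toLinearMap := by
  change LinearMap.trace ℂ _ ((((E.triv b).continuousLinearMapAt ℂ p).toLinearMap) ∘ₗ
    (A ∘L (E.triv b).symmL ℂ p).toLinearMap) = _
  rw [LinearMap.trace_comp_comm']
  change LinearMap.trace ℂ _
    (A ∘L ((E.triv b).symmL ℂ p ∘L (E.triv b).continuousLinearMapAt ℂ p)).toLinearMap = _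
  rw [symm_comp_mapAt b p hb]
  rfl

/-- The fibre varies with the point, so continuity is tested in a trivialization. There the trace is
that of the local matrix, by conjugation invariance, and it is a linear functional on a fixed
finite-dimensional space. -/
theorem IsSmoothHomOn.continuousOn_trace {U : Set X} {x : ∀ p, E.Fiber p →L[ℂ] E.Fiber p}
    (hx : IsSmoothHomOn E E U x) :
    ContinuousOn (fun p => LinearMap.trace ℂ (E.Fiber p) (x p).toLinearMap) U := by
  intro p hp
  have hpb : p ∈ (E.triv p).baseSet := FiberBundle.mem_baseSet_trivializationAt' p
  have hT : Continuous fun A : ModelFiber E.rank →L[ℂ] ModelFiber E.rank =>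
      LinearMap.trace ℂ _ A.toLinearMap :=
    (LinearMap.trace ℂ (ModelFiber E.rank) ∘ₗ
      ContinuousLinearMap.coeLM ℂ).continuous_of_finiteDimensional
  have h := (hT.comp_continuousOn (hx p p).continuousOn).congr
    (g := fun q => LinearMap.trace ℂ (E.Fiber q) (x q).toLinearMap)
    (fun q hq => (trace_localRep p q hq.2.1 (x q)).symm)
  have h1 := h p ⟨hp, hpb, hpb⟩
  rw [inter_self] at h1
  exact (continuousWithinAt_inter ((E.triv p).open_baseSet.mem_nhds hpb)).1 h1

theorem AreaForm.isContinuousForm_smulForm (σ : AreaForm X) {f : X → ℂ} (hf : Continuous f) :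
    IsContinuousForm (σ.smulForm f) := fun c => by
  have := (σ.smooth c).continuousOn.smul hf.continuousOn
  exact this

theorem HomSection.continuous_trace (x : HomSection E E) : Continuous (HomSection.trace x) :=
  continuousOn_univ.1 (IsSmoothHomOn.continuousOn_trace x.2)

end trace

/-! ### Algebra of sections, the operator `⋆`, and the trace functional. -/

section algebra

variable {X : Type u} [TopologicalSpace X] [ChartedSpace ℂ X]
variable {E F G H : HermitianBundle.{u, v} X}

namespace HomSection

theorem comp_assoc (z : HomSection G H) (y : HomSection F G) (x : HomSection E F) :
    comp (comp z y) x = comp z (comp y x) := rfl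

theorem add_comp (y y' : HomSection F G) (x : HomSection E F) :
    comp (y + y') x = comp y x + comp y' x := rfl

theorem sub_comp (y y' : HomSection F G) (x : HomSection E F) :
    comp (y - y') x = comp y x - comp y' x := rfl

theorem smul_comp (k : ℂ) (y : HomSection F G) (x : HomSection E F) :
    comp (k • y) x = k • comp y x := rfl

theorem comp_add (y : HomSection F G) (x x' : HomSection E F) :
    comp y (x + x') = comp y x + comp y x' :=
  Subtype.ext (funext fun _ => ContinuousLinearMap.comp_add _ _ _)

theorem comp_sub (y : HomSection F G) (x x' : HomSection E F) :
    comp y (x - x') = comp y x - comp y x' :=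
  Subtype.ext (funext fun _ => ContinuousLinearMap.comp_sub _ _ _)

theorem comp_smul (k : ℂ) (y : HomSection F G) (x : HomSection E F) :
    comp y (k • x) = k • comp y x :=
  Subtype.ext (funext fun _ => ContinuousLinearMap.comp_smul _ _ _)

theorem comp_neg (y : HomSection F G) (x : HomSection E F) : comp y (-x) = -comp y x :=
  Subtype.ext (funext fun _ => ContinuousLinearMap.comp_neg _ _)

theorem neg_comp (y : HomSection F G) (x : HomSection E F) : comp (-y) x = -comp y x := rfl

/-- Composition with a fixed section on the left, as a linear map. -/
def compₗ (y : HomSection F G) : HomSection E F →ₗ[ℂ] HomSection E G where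
  toFun := comp y
  map_add' := comp_add y
  map_smul' k := comp_smul k y

theorem comp_sum {ι : Type*} (s : Finset ι) (y : HomSection F G) (x : ι → HomSection E F) :
    comp y (∑ i ∈ s, x i) = ∑ i ∈ s, comp y (x i) :=
  map_sum (compₗ y) x s

theorem adj_add (x x' : HomSection E F) : adj (x + x') = adj x + adj x' :=
  Subtype.ext (funext fun _ => map_add _ _ _)

theorem adj_sub (x x' : HomSection E F) : adj (x - x') = adj x - adj x' :=
  Subtype.ext (funext fun _ => map_sub _ _ _)

theorem adj_smul (k : ℂ) (x : HomSection E F) :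
    adj (k • x) = (starRingEnd ℂ) k • adj x :=
  Subtype.ext (funext fun _ => LinearIsometryEquiv.map_smulₛₗ _ _ _)

theorem adj_adj (x : HomSection E F) : adj (adj x) = x :=
  Subtype.ext (funext fun _ => ContinuousLinearMap.adjoint_adjoint _)

theorem adj_comp (y : HomSection F G) (x : HomSection E F) :
    adj (comp y x) = comp (adj x) (adj y) :=
  Subtype.ext (funext fun _ => ContinuousLinearMap.adjoint_comp _ _)

theorem adj_sum {ι : Type*} (s : Finset ι) (x : ι → HomSection E F) :
    adj (∑ i ∈ s, x i) = ∑ i ∈ s, adj (x i) :=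
  map_sum (AddMonoidHom.mk' (adj (E := E) (F := F)) adj_add) x s

theorem adj_gaugeLie (θ : gaugeLie E) : adj θ.1 = -θ.1 :=
  Subtype.ext (funext fun p => θ.2 p)

theorem trace_comp_comm (y : HomSection F E) (x : HomSection E F) :
    trace (comp y x) = trace (comp x y) :=
  funext fun p => LinearMap.trace_comp_comm' (x.1 p).toLinearMap (y.1 p).toLinearMap

/-- In an orthonormal basis of the fibre the trace is `∑ ⟪e, x e⟫`, and passing to the adjoint swaps
the two arguments of each inner product. -/
theorem trace_adj (x : HomSection E E) (p : X) :
    trace (adj x) p = (starRingEnd ℂ) (trace x p) := by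
  simp only [trace, LinearMap.trace_eq_sum_inner _ (stdOrthonormalBasis ℂ (E.Fiber p)), map_sum]
  refine Finset.sum_congr rfl fun i _ => ?_
  rw [inner_conj_symm]
  exact ContinuousLinearMap.adjoint_inner_right _ _ _

/-- The pointwise squared Hilbert–Schmidt norm. -/
def hsSq (x : HomSection E F) (p : X) : ℝ :=
  ∑ i, ‖ContinuousLinearMap.adjoint (x.1 p) (stdOrthonormalBasis ℂ (F.Fiber p) i)‖ ^ 2

theorem trace_comp_adj (x : HomSection E F) :
    trace (comp x (adj x)) = fun p => (hsSq x p : ℂ) := by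
  funext p
  rw [trace, LinearMap.trace_eq_sum_inner _ (stdOrthonormalBasis ℂ (F.Fiber p)), hsSq,
    Complex.ofReal_sum]
  refine Finset.sum_congr rfl fun i _ => ?_
  rw [Complex.ofReal_pow, ← Complex.coe_algebraMap, ← inner_self_eq_norm_sq_to_K (𝕜 := ℂ)]
  exact (ContinuousLinearMap.adjoint_inner_left (x.1 p) _ _).symm

theorem hsSq_nonneg (x : HomSection E F) (p : X) : 0 ≤ hsSq x p :=
  Finset.sum_nonneg fun _ _ => by positivity

theorem eq_zero_of_hsSq {x : HomSection E F} {p : X} (h : hsSq x p = 0) : x.1 p = 0 := by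
  rw [hsSq, Finset.sum_eq_zero_iff_of_nonneg fun _ _ => by positivity] at h
  have h0 : ContinuousLinearMap.adjoint (x.1 p) = 0 := by
    refine ContinuousLinearMap.coe_injective
      ((stdOrthonormalBasis ℂ (F.Fiber p)).toBasis.ext fun i => ?_)
    simpa using h i (Finset.mem_univ i)
  simpa using congrArg ContinuousLinearMap.adjoint h0

end HomSection

theorem AreaForm.form_self_ne_zero (σ : AreaForm X) (p : X) : σ.form p (coordFrame p p) ≠ 0 :=
  (σ.pos p p (mem_chart_source ℂ p)).ne'

namespace AreaForm

variable (σ : AreaForm X)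

/-- The definition of `⋆y` uses one frame at each point. Proportionality of alternating two-forms on
a plane extends `y = (⋆y) σ` to every pair of vectors. -/
theorem apply_eq (y : HomTwoForm E F) (p : X) (w : Fin 2 → TangentPlane X p) :
    y.1 p w = (σ.form p w : ℂ) • (σ.star y).1 p := by
  have h := alternating_ratio (σ.form p) (y.1 p) (coordFrame p p) w
  change _ = (σ.form p w : ℂ) • ((((σ.form p (coordFrame p p))⁻¹ : ℝ) : ℂ) •
    y.1 p (coordFrame p p))
  rw [Complex.coe_smul, Complex.coe_smul, smul_comm, eq_inv_smul_iff₀ (σ.form_self_ne_zero p)]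
  exact h

theorem star_injective : Function.Injective (σ.star (E := E) (F := F)) := fun y y' h =>
  Subtype.ext (funext fun p => AlternatingMap.ext fun w => by
    rw [σ.apply_eq y, σ.apply_eq y', h])

theorem star_add (y y' : HomTwoForm E F) : σ.star (y + y') = σ.star y + σ.star y' :=
  Subtype.ext (funext fun _ => smul_add _ _ _)

theorem star_smul (k : ℂ) (y : HomTwoForm E F) : σ.star (k • y) = k • σ.star y :=
  Subtype.ext (funext fun _ => smul_comm _ _ _)

/-- The operator `⋆` as a linear map. -/
def starₗ : HomTwoForm E F →ₗ[ℂ] HomSection E F where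
  toFun := σ.star
  map_add' := σ.star_add
  map_smul' := σ.star_smul

theorem star_sub (y y' : HomTwoForm E F) : σ.star (y - y') = σ.star y - σ.star y' :=
  map_sub σ.starₗ y y'

theorem star_sum {ι : Type*} (s : Finset ι) (y : ι → HomTwoForm E F) :
    σ.star (∑ i ∈ s, y i) = ∑ i ∈ s, σ.star (y i) :=
  map_sum σ.starₗ y s

theorem star_compLeft (x : HomSection F G) (y : HomTwoForm E F) :
    σ.star (HomTwoForm.compLeft x y) = HomSection.comp x (σ.star y) :=
  Subtype.ext (funext fun _ => (ContinuousLinearMap.comp_smul _ _ _).symm)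

theorem star_compRight (y : HomTwoForm F G) (x : HomSection E F) :
    σ.star (HomTwoForm.compRight y x) = HomSection.comp (σ.star y) x := rfl

/-- The two-form `x σ`. -/
def mulForm (x : HomSection E F) : HomTwoForm E F :=
  ⟨fun p => LinearMap.compAlternatingMap (LinearMap.toSpanSingleton ℝ _ (x.1 p)) (σ.form p),
    fun c => by
      have h : ContMDiffOn 𝓘(ℝ, ℂ) 𝓘(ℝ, ℂ) ∞ (fun p => (σ.form p (coordFrame c p) : ℂ))
          (chartAt ℂ c).source :=
        Complex.ofRealCLM.contDiff.contMDiff.comp_contMDiffOn (σ.smooth c)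
      exact IsSmoothHomOn.smul h (IsSmoothHomOn.mono (subset_univ _) x.2)⟩

/-- Gives surjectivity of `⋆`: a two-form exists with any prescribed `⋆`. Non-degeneracy of the
complex form relies on this. -/
theorem star_mulForm (x : HomSection E F) : σ.star (σ.mulForm x) = x := by
  refine Subtype.ext (funext fun p => ?_)
  change (((σ.form p (coordFrame p p))⁻¹ : ℝ) : ℂ) • (σ.form p (coordFrame p p)) • x.1 p = x.1 p
  rw [Complex.coe_smul, inv_smul_smul₀ (σ.form_self_ne_zero p)]

theorem smulForm_trace_star (y : HomTwoForm E E) :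
    σ.smulForm (HomSection.trace (σ.star y)) = HomTwoForm.trace y := by
  funext p
  refine AlternatingMap.ext fun w => ?_
  change σ.form p w • LinearMap.trace ℂ (E.Fiber p) ((σ.star y).1 p).toLinearMap =
    LinearMap.trace ℂ (E.Fiber p) (y.1 p w).toLinearMap
  rw [σ.apply_eq y, ContinuousLinearMap.toLinearMap_smul, map_smul, Complex.real_smul, smul_eq_mul]

theorem isContinuousForm_hsSq (x : HomSection E F) :
    IsContinuousForm (σ.smulForm fun p => (HomSection.hsSq x p : ℂ)) := by
  rw [← HomSection.trace_comp_adj]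
  exact σ.isContinuousForm_smulForm (HomSection.continuous_trace _)

variable [CompactSpace X] [T2Space X] [IsManifold 𝓘(ℂ) ω X]

/-- The functional `x ↦ ∫_X tr(x) σ` on sections of `End(E)`. -/
def intTrace : HomSection E E →ₗ[ℂ] ℂ where
  toFun x := integral (σ.smulForm (HomSection.trace x))
  map_add' x y := by
    rw [← integral_add (σ.isContinuousForm_smulForm (HomSection.continuous_trace x))
      (σ.isContinuousForm_smulForm (HomSection.continuous_trace y))]
    congr 1
    funext p
    refine AlternatingMap.ext fun w => ?_
    simp [smulForm, HomSection.trace]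
  map_smul' k x := by
    rw [RingHom.id_apply, smul_eq_mul, ← integral_smul]
    congr 1
    funext p
    refine AlternatingMap.ext fun w => ?_
    simp [smulForm, HomSection.trace, mul_left_comm]

/-- The left side does not involve `σ`, so any area form may be used to bring `omegaC` and `pairC`
under the same functional as the real case. -/
theorem integral_trace (y : HomTwoForm E E) :
    integral (HomTwoForm.trace y) = σ.intTrace (σ.star y) := by
  rw [← σ.smulForm_trace_star]; rfl

theorem intTrace_comm (y : HomSection F E) (x : HomSection E F) :
    σ.intTrace (HomSection.comp y x) = σ.intTrace (HomSection.comp x y) :=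
  congrArg (fun f => integral (σ.smulForm f)) (HomSection.trace_comp_comm y x)

theorem intTrace_adj (x : HomSection E E) :
    σ.intTrace (HomSection.adj x) = (starRingEnd ℂ) (σ.intTrace x) :=
  integral_conj fun p w => by simp [smulForm, HomSection.trace_adj]

theorem intTrace_comp_adj_nonneg (x : HomSection E F) :
    0 ≤ (σ.intTrace (HomSection.comp x (HomSection.adj x))).re := by
  change 0 ≤ (integral (σ.smulForm _)).re
  rw [HomSection.trace_comp_adj]
  exact integral_smulForm_nonneg σ (HomSection.hsSq_nonneg x) (σ.isContinuousForm_hsSq x)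

theorem eq_zero_of_intTrace_comp_adj {x : HomSection E F}
    (h : (σ.intTrace (HomSection.comp x (HomSection.adj x))).re = 0) : x = 0 := by
  change (integral (σ.smulForm _)).re = 0 at h
  rw [HomSection.trace_comp_adj] at h
  exact Subtype.ext (funext fun p => HomSection.eq_zero_of_hsSq
    (eq_zero_of_integral_smulForm σ (HomSection.hsSq_nonneg x) (σ.isContinuousForm_hsSq x) h p))

end AreaForm

/-! ### Conjugation by gauge transformations -/

/-- The action `x ↦ h x g⁻¹` of gauge transformations on sections of `Hom(E, F)`. -/
def gaugeConj (h : gaugeSubgroup F) (g : gaugeSubgroup E) (x : HomSection E F) : HomSection E F :=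
  HomSection.comp (HomSection.comp (gaugeHom h) x) (gaugeHom g⁻¹)

theorem gaugeHom_inv_comp (g : gaugeSubgroup F) (x : HomSection E F) :
    HomSection.comp (gaugeHom g⁻¹) (HomSection.comp (gaugeHom g) x) = x := by
  refine Subtype.ext (funext fun p => ContinuousLinearMap.ext fun w => ?_)
  exact congrArg (fun A : F.Fiber p →L[ℂ] F.Fiber p => A (x.1 p w)) (Unitary.coe_star_mul_self (g.1 p))

/-- Definitional, since inversion of unitaries is `star`. This is what makes adjoints compatible
with conjugation, and the real structure needs it. -/
theorem adj_gaugeHom (g : gaugeSubgroup E) : HomSection.adj (gaugeHom g) = gaugeHom g⁻¹ := rfl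

theorem comp_gaugeConj (k : gaugeSubgroup G) (h : gaugeSubgroup F) (g : gaugeSubgroup E)
    (y : HomSection F G) (x : HomSection E F) :
    HomSection.comp (gaugeConj k h y) (gaugeConj h g x) =
      gaugeConj k g (HomSection.comp y x) := by
  simp only [gaugeConj, HomSection.comp_assoc, gaugeHom_inv_comp]

theorem adj_gaugeConj (h : gaugeSubgroup F) (g : gaugeSubgroup E) (x : HomSection E F) :
    HomSection.adj (gaugeConj h g x) = gaugeConj g h (HomSection.adj x) := by
  simp only [gaugeConj, HomSection.adj_comp, adj_gaugeHom, inv_inv, HomSection.comp_assoc]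

theorem gaugeConj_sub (h : gaugeSubgroup F) (g : gaugeSubgroup E) (x x' : HomSection E F) :
    gaugeConj h g (x - x') = gaugeConj h g x - gaugeConj h g x' := by
  simp only [gaugeConj, HomSection.comp_sub, HomSection.sub_comp]

theorem AreaForm.intTrace_gaugeConj [CompactSpace X] [T2Space X] [IsManifold 𝓘(ℂ) ω X]
    (σ : AreaForm X) (g : gaugeSubgroup E) (x : HomSection E E) :
    σ.intTrace (gaugeConj g g x) = σ.intTrace x := by
  rw [gaugeConj, intTrace_comm, gaugeHom_inv_comp]

end algebra

/-- A moment pairing restricts to a line as an exact polynomial of degree at most two, so no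
topology on the infinite-dimensional space `W` and no remainder estimate is required. -/
theorem hasLineDerivAt_of_quadratic {𝕜 W : Type*} [RCLike 𝕜] [AddCommGroup W] [Module 𝕜 W]
    {f : W → 𝕜} {D Q : 𝕜} {z w : W} (h : ∀ t : 𝕜, f (z + t • w) = f z + t * D + t ^ 2 * Q) :
    HasLineDerivAt 𝕜 f D z w := by
  have h1 : HasDerivAt (fun t : 𝕜 => f z + t * D + t ^ 2 * Q)
      (1 * D + (2 : ℕ) * (0 : 𝕜) ^ (2 - 1) * Q) 0 :=
    (((hasDerivAt_id (0 : 𝕜)).mul_const D).const_add (f z)).add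
      ((hasDerivAt_pow 2 (0 : 𝕜)).mul_const Q)
  simp only [HasLineDerivAt, h]
  simpa using h1

/-! ### The contribution of a single edge to the moment pairings. -/

section edges

variable {X : Type u} [TopologicalSpace X] [ChartedSpace ℂ X]
variable {E F : HermitianBundle.{u, v} X}
variable [CompactSpace X] [T2Space X] [IsManifold 𝓘(ℂ) ω X] (σ : AreaForm X)

open HomSection

/-- The contribution of an edge to the pairing of the real moment map with `𝔤`. -/
def edgePairR (θ : gaugeLie E) (η : gaugeLie F) (x : HomSection E F) (y : HomSection F E) : ℂ :=
  σ.intTrace (comp η.1 (comp x (adj x) - comp (adj y) y)) -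
    σ.intTrace (comp θ.1 (comp (adj x) x - comp y (adj y)))

/-- The contribution of an edge to the pairing of the complex moment map with `𝔤`. -/
def edgePairC (θ : gaugeLie E) (η : gaugeLie F) (x : HomSection E F) (y : HomSection F E) : ℂ :=
  σ.intTrace (comp η.1 (comp x y)) - σ.intTrace (comp θ.1 (comp y x))

/-- Since `θ^* = -θ`, the adjoint of `θ x y^*` is `-y x^* θ`. Cyclicity then gives `I(θ y x^*) =
-conj I(θ x y^*)`, and the imaginary parts agree. -/
theorem intTrace_gaugeLie_comp_im (θ : gaugeLie E) (x y : HomSection F E) :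
    (σ.intTrace (comp θ.1 (comp x (adj y)))).im = (σ.intTrace (comp θ.1 (comp y (adj x)))).im := by
  have h := σ.intTrace_adj (comp θ.1 (comp x (adj y)))
  rw [adj_comp, adj_comp, adj_adj, adj_gaugeLie, comp_neg, map_neg, σ.intTrace_comm] at h
  have h1 := congrArg Complex.im h
  simp only [Complex.neg_im, Complex.conj_im, neg_inj] at h1
  exact h1.symm

theorem edgePairR_add_smul (θ : gaugeLie E) (η : gaugeLie F) (x x' : HomSection E F)
    (y y' : HomSection F E) (t : ℝ) :
    (edgePairR σ θ η (x + (t : ℂ) • x') (y + (t : ℂ) • y')).im =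
      (edgePairR σ θ η x y).im +
        t * (2 * (σ.intTrace (comp (comp η.1 x - comp x θ.1) (adj x') +
          comp (adj y') (comp θ.1 y - comp y η.1))).im) +
        t ^ 2 * (edgePairR σ θ η x' y').im := by
  -- The four quadratic terms `x x^*`, `x^* x`, `y y^*`, `y^* y` each produce two cross terms; these
  -- equalities merge each pair into one with coefficient 2.
  have h1 := intTrace_gaugeLie_comp_im σ η x x'
  have h2 := intTrace_gaugeLie_comp_im σ θ (adj x) (adj x')
  have h3 := intTrace_gaugeLie_comp_im σ θ y y'
  have h4 := intTrace_gaugeLie_comp_im σ η (adj y) (adj y')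
  -- Cyclic rotations that bring the Lie algebra element to the front, so that the terms of the
  -- symplectic form match the cross terms.
  have c1 : σ.intTrace (comp x (comp θ.1 (adj x'))) = σ.intTrace (comp θ.1 (comp (adj x') x)) := by
    rw [σ.intTrace_comm]; rfl
  have c2 : σ.intTrace (comp (adj y') (comp θ.1 y)) = σ.intTrace (comp θ.1 (comp y (adj y'))) := by
    rw [σ.intTrace_comm]; rfl
  have c3 : σ.intTrace (comp (adj y') (comp y η.1)) = σ.intTrace (comp η.1 (comp (adj y') y)) := by
    rw [← comp_assoc, σ.intTrace_comm]
  simp only [adj_adj] at h2 h4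
  simp only [edgePairR, adj_add, adj_smul, add_comp, sub_comp, smul_comp, comp_add, comp_sub,
    comp_smul, comp_assoc, map_add, map_sub, map_smul, Complex.conj_ofReal, smul_eq_mul, c1, c2, c3,
    Complex.add_im, Complex.sub_im, Complex.im_ofReal_mul, h1, h2, h3, h4, mul_add, mul_sub, smul_add]
  ring

/-- No adjoint occurs, so `t` may be complex. The two cross terms stay distinct and become the two
halves of `omegaC`, and cyclicity alone suffices. -/
theorem edgePairC_add_smul (θ : gaugeLie E) (η : gaugeLie F) (x x' : HomSection E F)
    (y y' : HomSection F E) (t : ℂ) :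
    edgePairC σ θ η (x + t • x') (y + t • y') =
      edgePairC σ θ η x y +
        t * σ.intTrace (comp (comp η.1 x - comp x θ.1) y' - comp x' (comp θ.1 y - comp y η.1)) +
        t ^ 2 * edgePairC σ θ η x' y' := by
  have c1 : σ.intTrace (comp x (comp θ.1 y')) = σ.intTrace (comp θ.1 (comp y' x)) := by
    rw [σ.intTrace_comm]; rfl
  have c2 : σ.intTrace (comp x' (comp θ.1 y)) = σ.intTrace (comp θ.1 (comp y x')) := by
    rw [σ.intTrace_comm]; rfl
  have c3 : σ.intTrace (comp x' (comp y η.1)) = σ.intTrace (comp η.1 (comp x' y)) := by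
    rw [← comp_assoc, σ.intTrace_comm]
  simp only [edgePairC, add_comp, sub_comp, smul_comp, comp_add, comp_sub,
    comp_smul, comp_assoc, map_add, map_sub, map_smul, smul_eq_mul, c1, c2, c3]
  ring

theorem edgePairR_gaugeConj (g : gaugeSubgroup E) (h : gaugeSubgroup F) (θ : gaugeLie E)
    (η : gaugeLie F) (x : HomSection E F) (y : HomSection F E) :
    edgePairR σ (gaugeAd g θ) (gaugeAd h η) (gaugeConj h g x) (gaugeConj g h y) =
      edgePairR σ θ η x y := by
  -- The adjoint action is itself conjugation, so each whole word is conjugated and the trace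
  -- functional absorbs it.
  change σ.intTrace (comp (gaugeConj h h η.1) _) - σ.intTrace (comp (gaugeConj g g θ.1) _) = _
  simp only [adj_gaugeConj, comp_gaugeConj, ← gaugeConj_sub, σ.intTrace_gaugeConj,
    edgePairR]

theorem edgePairC_gaugeConj (g : gaugeSubgroup E) (h : gaugeSubgroup F) (θ : gaugeLie E)
    (η : gaugeLie F) (x : HomSection E F) (y : HomSection F E) :
    edgePairC σ (gaugeAd g θ) (gaugeAd h η) (gaugeConj h g x) (gaugeConj g h y) =
      edgePairC σ θ η x y := by
  change σ.intTrace (comp (gaugeConj h h η.1) _) - σ.intTrace (comp (gaugeConj g g θ.1) _) = _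
  simp only [comp_gaugeConj, σ.intTrace_gaugeConj, edgePairC]

end edges

/-! ### Summation over edges and the two Hamiltonian actions. -/

section quiver

open HomSection

variable {X : Type u} [TopologicalSpace X] [ChartedSpace ℂ X]
variable {V : Type*} [Quiver.{w + 1} V] {E : V → HermitianBundle.{u, v} X}

theorem EdgeRep.add_x (z z' : EdgeRep E) {i j : V} (a : i ⟶ j) :
    (z + z').x i j a = z.x i j a + z'.x i j a := rfl

theorem EdgeRep.add_y (z z' : EdgeRep E) {i j : V} (a : i ⟶ j) :
    (z + z').y i j a = z.y i j a + z'.y i j a := rfl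

theorem EdgeRep.smul_x (k : ℂ) (z : EdgeRep E) {i j : V} (a : i ⟶ j) :
    (k • z).x i j a = k • z.x i j a := rfl

theorem EdgeRep.smul_y (k : ℂ) (z : EdgeRep E) {i j : V} (a : i ⟶ j) :
    (k • z).y i j a = k • z.y i j a := rfl

theorem EdgeRep.real_smul (k : ℝ) (z : EdgeRep E) : k • z = (k : ℂ) • z := rfl

theorem gauge_smul_x (g : GaugeGroup E) (z : EdgeRep E) {i j : V} (a : i ⟶ j) :
    (g • z).x i j a = gaugeConj (g j) (g i) (z.x i j a) := rfl

theorem star_gauge_smul_y (σ : AreaForm X) (g : GaugeGroup E) (z : EdgeRep E) {i j : V}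
    (a : i ⟶ j) :
    σ.star ((g • z).y i j a) = gaugeConj (g i) (g j) (σ.star (z.y i j a)) := by
  rw [gaugeConj, ← σ.star_compLeft]; rfl

theorem infAction_x (θ : GaugeAlgebra E) (z : EdgeRep E) {i j : V} (a : i ⟶ j) :
    (infAction θ z).x i j a = comp (θ j).1 (z.x i j a) - comp (z.x i j a) (θ i).1 := rfl

theorem star_infAction_y (σ : AreaForm X) (θ : GaugeAlgebra E) (z : EdgeRep E) {i j : V}
    (a : i ⟶ j) :
    σ.star ((infAction θ z).y i j a) =
      comp (θ i).1 (σ.star (z.y i j a)) - comp (σ.star (z.y i j a)) (θ j).1 := by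
  rw [← σ.star_compLeft, ← σ.star_compRight, ← σ.star_sub]; rfl

theorem EdgeRep.eq_zero (σ : AreaForm X) {z : EdgeRep E} (hx : ∀ i j a, z.x i j a = 0)
    (hy : ∀ i j a, σ.star (z.y i j a) = 0) : z = 0 := by
  refine EdgeRep.ext (funext fun i => funext fun j => funext fun a => hx i j a)
    (funext fun i => funext fun j => funext fun a => σ.star_injective ?_)
  rw [hy]
  exact (map_zero σ.starₗ).symm

variable [Fintype V] [∀ i j : V, Fintype (i ⟶ j)]

theorem adj_muR (σ : AreaForm X) (z : EdgeRep E) (i : V) : adj (muR σ z i) = muR σ z i := by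
  simp only [muR, adj_sub, adj_sum, adj_comp, adj_adj]

variable [CompactSpace X] [T2Space X] [IsManifold 𝓘(ℂ) ω X] (σ : AreaForm X)

/-- Each edge is counted once at its head and once at its tail. Swapping the two vertex sums in the
incoming part collects both contributions at the edge, with `θ` taken at the head for `A` and at the
tail for `B`. -/
theorem sum_intTrace_comp (θ : GaugeAlgebra E)
    (A : ∀ i j : V, (i ⟶ j) → HomSection (E j) (E j))
    (B : ∀ i j : V, (i ⟶ j) → HomSection (E i) (E i)) :
    ∑ i, σ.intTrace (comp (θ i).1 ((∑ j, ∑ a : j ⟶ i, A j i a) - ∑ j, ∑ a : i ⟶ j, B i j a)) =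
      ∑ i, ∑ j, ∑ a : i ⟶ j,
        (σ.intTrace (comp (θ j).1 (A i j a)) - σ.intTrace (comp (θ i).1 (B i j a))) := by
  simp only [comp_sub, comp_sum, map_sub, map_sum, Finset.sum_sub_distrib]
  rw [Finset.sum_comm]

theorem pairR_muR (z : EdgeRep E) (θ : GaugeAlgebra E) :
    pairR σ (muR σ z) θ = ∑ i, ∑ j, ∑ a : i ⟶ j,
      (edgePairR σ (θ i) (θ j) (z.x i j a) (σ.star (z.y i j a))).im := by
  have h := congrArg Complex.im (sum_intTrace_comp σ θ
    (fun i j a => comp (z.x i j a) (adj (z.x i j a)) -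
      comp (adj (σ.star (z.y i j a))) (σ.star (z.y i j a)))
    (fun i j a => comp (adj (z.x i j a)) (z.x i j a) -
      comp (σ.star (z.y i j a)) (adj (σ.star (z.y i j a)))))
  refine h.trans ?_
  simp only [Complex.im_sum, edgePairR]

theorem pairC_muC (z : EdgeRep E) (θ : GaugeAlgebra E) :
    pairC (muC z) θ = ∑ i, ∑ j, ∑ a : i ⟶ j,
      edgePairC σ (θ i) (θ j) (z.x i j a) (σ.star (z.y i j a)) := by
  simp only [pairC, muC, σ.integral_trace, σ.star_compLeft, σ.star_sub, σ.star_sum,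
    σ.star_compRight]
  exact sum_intTrace_comp σ θ (fun i j a => comp (z.x i j a) (σ.star (z.y i j a)))
    (fun i j a => comp (σ.star (z.y i j a)) (z.x i j a))

theorem omegaR_eq (z z' : EdgeRep E) :
    omegaR σ z z' = ∑ i, ∑ j, ∑ a : i ⟶ j, 2 * (σ.intTrace
      (comp (z.x i j a) (adj (z'.x i j a)) +
        comp (adj (σ.star (z'.y i j a))) (σ.star (z.y i j a)))).im := by
  simp only [← Finset.mul_sum, ← Complex.im_sum]
  rfl

theorem omegaC_eq (z z' : EdgeRep E) :
    omegaC z z' = ∑ i, ∑ j, ∑ a : i ⟶ j, σ.intTrace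
      (comp (z.x i j a) (σ.star (z'.y i j a)) - comp (z'.x i j a) (σ.star (z.y i j a))) := by
  simp only [omegaC, σ.integral_trace, σ.star_sub, σ.star_compLeft]

theorem sum_edges_eq_zero_iff {f : ∀ i j : V, (i ⟶ j) → ℝ} (hf : ∀ i j a, 0 ≤ f i j a) :
    ∑ i, ∑ j, ∑ a : i ⟶ j, f i j a = 0 ↔ ∀ i j a, f i j a = 0 := by
  have h1 : ∀ i j, 0 ≤ ∑ a : i ⟶ j, f i j a := fun i j => Finset.sum_nonneg fun a _ => hf i j a
  have h2 : ∀ i, 0 ≤ ∑ j, ∑ a : i ⟶ j, f i j a := fun i => Finset.sum_nonneg fun j _ => h1 i j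
  simp only [Finset.sum_eq_zero_iff_of_nonneg fun i _ => h2 i,
    Finset.sum_eq_zero_iff_of_nonneg fun j _ => h1 _ j,
    Finset.sum_eq_zero_iff_of_nonneg fun a _ => hf _ _ a, Finset.mem_univ, true_imp_iff]

/-- Positive definiteness of the `L²` norm on edge representations, to which both non-degeneracy
proofs reduce. -/
theorem EdgeRep.eq_zero_of_sum {z : EdgeRep E}
    (h : ∑ i, ∑ j, ∑ a : i ⟶ j, (σ.intTrace (comp (z.x i j a) (adj (z.x i j a)) +
      comp (adj (σ.star (z.y i j a))) (σ.star (z.y i j a)))).re = 0) : z = 0 := by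
  have hx : ∀ i j (a : i ⟶ j), 0 ≤ (σ.intTrace (comp (z.x i j a) (adj (z.x i j a)))).re :=
    fun i j a => σ.intTrace_comp_adj_nonneg _
  have hy : ∀ i j (a : i ⟶ j),
      0 ≤ (σ.intTrace (comp (adj (σ.star (z.y i j a))) (σ.star (z.y i j a)))).re := fun i j a => by
    rw [σ.intTrace_comm]
    exact σ.intTrace_comp_adj_nonneg _
  simp only [map_add, Complex.add_re] at h
  rw [sum_edges_eq_zero_iff fun i j a => add_nonneg (hx i j a) (hy i j a)] at h
  refine EdgeRep.eq_zero σ (fun i j a => σ.eq_zero_of_intTrace_comp_adj ?_)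
    (fun i j a => σ.eq_zero_of_intTrace_comp_adj ?_)
  · linarith [h i j a, hx i j a, hy i j a]
  · rw [σ.intTrace_comm]
    linarith [h i j a, hx i j a, hy i j a]

theorem isHamiltonianAction_omegaR :
    IsHamiltonianAction ℝ GaugeGroup.ad (infAction (E := E)) (omegaR σ)
      (fun z θ => pairR σ (muR σ z) θ) where
  form_add z z' w := by
    simp only [omegaR_eq, EdgeRep.add_x, EdgeRep.add_y, σ.star_add, add_comp, comp_add, map_add,
      Complex.add_im, mul_add, Finset.sum_add_distrib]
    ring
  form_smul k z w := by
    simp only [omegaR_eq, EdgeRep.real_smul, EdgeRep.smul_x, EdgeRep.smul_y, σ.star_smul,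
      smul_comp, comp_smul, ← smul_add, map_smul, smul_eq_mul, Complex.im_ofReal_mul,
      Finset.mul_sum, mul_left_comm]
  form_skew z w := by
    simp only [omegaR_eq, ← Finset.sum_neg_distrib]
    refine Finset.sum_congr rfl fun i _ => Finset.sum_congr rfl fun j _ =>
      Finset.sum_congr rfl fun a _ => ?_
    -- The adjoint of the edge integrand is the integrand with `z` and `w` exchanged, and
    -- conjugation changes the sign of the imaginary part.
    have h := congrArg Complex.im (σ.intTrace_adj (comp (z.x i j a) (adj (w.x i j a)) +
        comp (adj (σ.star (w.y i j a))) (σ.star (z.y i j a))))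
    simp only [adj_add, adj_comp, adj_adj, Complex.conj_im] at h
    rw [h]
    ring
  form_nondegenerate z h := by
    refine EdgeRep.eq_zero_of_sum σ ?_
    -- Conjugate linearity in the second slot turns `-i` into `i`, and `Im (i c) = Re c` yields
    -- twice the squared norm of `z`.
    have h1 := h ((-Complex.I) • z)
    simp only [omegaR_eq, EdgeRep.smul_x, EdgeRep.smul_y, σ.star_smul, adj_smul, smul_comp,
      comp_smul, ← smul_add, map_smul, map_neg, Complex.conj_I, neg_neg, smul_eq_mul,
      Complex.I_mul_im, ← Finset.mul_sum] at h1
    exact (mul_eq_zero.1 h1).resolve_left two_ne_zero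
  form_invariant g z w := by
    simp only [omegaR_eq, gauge_smul_x, star_gauge_smul_y, adj_gaugeConj, comp_gaugeConj, map_add,
      σ.intTrace_gaugeConj]
  moment_add z θ η := by
    simp only [pairR_muR, ← Finset.sum_add_distrib]
    refine Finset.sum_congr rfl fun i _ => Finset.sum_congr rfl fun j _ =>
      Finset.sum_congr rfl fun a _ => ?_
    rw [← Complex.add_im]
    congr 1
    change σ.intTrace (comp ((θ j).1 + (η j).1) _) - σ.intTrace (comp ((θ i).1 + (η i).1) _) = _
    simp only [edgePairR, add_comp, map_add]
    ring
  moment_smul z k θ := by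
    simp only [pairR_muR, Finset.mul_sum]
    refine Finset.sum_congr rfl fun i _ => Finset.sum_congr rfl fun j _ =>
      Finset.sum_congr rfl fun a _ => ?_
    change (σ.intTrace (comp ((k : ℂ) • (θ j).1) _) - σ.intTrace (comp ((k : ℂ) • (θ i).1) _)).im = _
    simp only [edgePairR, smul_comp, map_smul, smul_eq_mul, ← mul_sub, Complex.im_ofReal_mul,
      RCLike.ofReal_real_eq_id, id_eq]
  moment_deriv θ z w := by
    -- The second-order coefficient is the same quadratic function evaluated at the direction `w`.
    refine hasLineDerivAt_of_quadratic (Q := pairR σ (muR σ w) θ) fun t => ?_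
    simp only [pairR_muR, omegaR_eq, infAction_x, star_infAction_y, EdgeRep.add_x, EdgeRep.add_y,
      EdgeRep.real_smul, EdgeRep.smul_x, EdgeRep.smul_y, σ.star_add, σ.star_smul,
      edgePairR_add_smul, Finset.sum_add_distrib, Finset.mul_sum]
  moment_equivariant g z θ := by
    simp only [pairR_muR, gauge_smul_x, star_gauge_smul_y, GaugeGroup.ad, edgePairR_gaugeConj]

-- The form and the moment map are independent of `σ`. The area form is an auxiliary choice that
-- turns two-forms into sections and supplies the test vector for non-degeneracy.
include σ in
theorem isHamiltonianAction_omegaC :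
    IsHamiltonianAction ℂ GaugeGroup.ad (infAction (E := E)) omegaC
      (fun z θ => pairC (muC z) θ) where
  form_add z z' w := by
    simp only [omegaC_eq σ, EdgeRep.add_x, EdgeRep.add_y, σ.star_add, add_comp, comp_add, map_add,
      map_sub, Finset.sum_add_distrib, Finset.sum_sub_distrib]
    ring
  form_smul k z w := by
    simp only [omegaC_eq σ, EdgeRep.smul_x, EdgeRep.smul_y, σ.star_smul,
      smul_comp, comp_smul, map_sub, map_smul, smul_eq_mul, mul_sub, Finset.mul_sum]
  form_skew z w := by
    simp only [omegaC_eq σ, ← Finset.sum_neg_distrib, ← map_neg, neg_sub]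
  form_nondegenerate z h := by
    refine EdgeRep.eq_zero_of_sum σ ?_
    -- The test vector `(-(⋆y)^*, x^* σ)` turns the integrand `x y' - x' y` into `x x^* + (⋆y)^*
    -- (⋆y)`, which is the squared norm of `z`.
    have h1 := congrArg Complex.re (h ⟨fun i j a => -adj (σ.star (z.y i j a)),
      fun i j a => σ.mulForm (adj (z.x i j a))⟩)
    simpa only [omegaC_eq σ, σ.star_mulForm, neg_comp, sub_neg_eq_add, Complex.re_sum,
      Complex.zero_re] using h1
  form_invariant g z w := by
    simp only [omegaC_eq σ, gauge_smul_x, star_gauge_smul_y, comp_gaugeConj, map_sub,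
      σ.intTrace_gaugeConj]
  moment_add z θ η := by
    simp only [pairC_muC σ, ← Finset.sum_add_distrib]
    refine Finset.sum_congr rfl fun i _ => Finset.sum_congr rfl fun j _ =>
      Finset.sum_congr rfl fun a _ => ?_
    change σ.intTrace (comp ((θ j).1 + (η j).1) _) - σ.intTrace (comp ((θ i).1 + (η i).1) _) = _
    simp only [edgePairC, add_comp, map_add]
    ring
  moment_smul z k θ := by
    simp only [pairC_muC σ, Finset.mul_sum]
    refine Finset.sum_congr rfl fun i _ => Finset.sum_congr rfl fun j _ =>
      Finset.sum_congr rfl fun a _ => ?_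
    change σ.intTrace (comp ((k : ℂ) • (θ j).1) _) - σ.intTrace (comp ((k : ℂ) • (θ i).1) _) = _
    simp only [edgePairC, smul_comp, map_smul, smul_eq_mul, ← mul_sub]
    rfl
  moment_deriv θ z w := by
    refine hasLineDerivAt_of_quadratic (Q := pairC (muC w) θ) fun t => ?_
    simp only [pairC_muC σ, omegaC_eq σ, infAction_x, star_infAction_y, EdgeRep.add_x,
      EdgeRep.add_y, EdgeRep.smul_x, EdgeRep.smul_y, σ.star_add, σ.star_smul,
      edgePairC_add_smul, Finset.sum_add_distrib, Finset.mul_sum]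
  moment_equivariant g z θ := by
    simp only [pairC_muC σ, gauge_smul_x, star_gauge_smul_y, GaugeGroup.ad, edgePairC_gaugeConj]

end quiver

/-! ### The vector field generated by a Lie algebra element. -/

section infinitesimal

variable {X : Type u} [TopologicalSpace X] [ChartedSpace ℂ X]
variable {E F : HermitianBundle.{u, v} X}

theorem hasDerivAt_gaugeExp_smul (θ : gaugeLie E) (p : X) :
    HasDerivAt (fun t : ℝ => (gaugeHom (gaugeExp (t • θ))).1 p) (θ.1.1 p) 0 := by
  have h := hasDerivAt_exp_smul_const (𝕂 := ℝ) (θ.1.1 p) (0 : ℝ)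
  simp only [zero_smul, NormedSpace.exp_zero, one_mul] at h
  exact h

/-- The inverse of a unitary is its adjoint, and `exp(θ)^* = exp(θ^*) = exp(-θ)`. -/
theorem gaugeExp_inv (θ : gaugeLie E) : (gaugeExp θ)⁻¹ = gaugeExp (-θ) := by
  refine Subtype.ext (funext fun p => Subtype.ext ?_)
  change star (NormedSpace.exp (θ.1.1 p)) = NormedSpace.exp (-θ.1.1 p)
  rw [NormedSpace.star_exp, θ.2 p]

theorem hasDerivAt_gaugeExp_inv_smul (θ : gaugeLie E) (p : X) :
    HasDerivAt (fun t : ℝ => (gaugeHom (gaugeExp (t • θ))⁻¹).1 p) (-θ.1.1 p) 0 := by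
  simp only [gaugeExp_inv, ← smul_neg]
  exact hasDerivAt_gaugeExp_smul (-θ) p

theorem hasDerivAt_gaugeExp_conj (η : gaugeLie F) (θ : gaugeLie E) (p : X)
    (A : E.Fiber p →L[ℂ] F.Fiber p) :
    HasDerivAt (fun t : ℝ => (gaugeHom (gaugeExp (t • η))).1 p ∘L A ∘L
      (gaugeHom (gaugeExp (t • θ))⁻¹).1 p) (η.1.1 p ∘L A - A ∘L θ.1.1 p) 0 := by
  -- The factors map between different fibres, so the product rule is that of the bilinear
  -- composition map rather than of one algebra.
  have hB : ∀ {E F G : HermitianBundle.{u, v} X} {f : ℝ → (F.Fiber p →L[ℂ] G.Fiber p)}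
      {k : ℝ → (E.Fiber p →L[ℂ] F.Fiber p)} {f' : F.Fiber p →L[ℂ] G.Fiber p}
      {k' : E.Fiber p →L[ℂ] F.Fiber p}, HasDerivAt f f' 0 → HasDerivAt k k' 0 →
      HasDerivAt (fun t => f t ∘L k t) (f 0 ∘L k' + f' ∘L k 0) 0 :=
    fun {E F G _ _ _ _} hf hk => ((ContinuousLinearMap.compL ℂ (E.Fiber p) (F.Fiber p)
      (G.Fiber p)).bilinearRestrictScalars ℝ).hasDerivAt_of_bilinear (fun _ => hf) (fun _ => hk)
  have h2 := hB (hasDerivAt_gaugeExp_smul η p)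
    (hB (hasDerivAt_const (0 : ℝ) A) (hasDerivAt_gaugeExp_inv_smul θ p))
  refine h2.congr_deriv ?_
  have e0 : ∀ {E : HermitianBundle.{u, v} X} (θ : gaugeLie E),
      (gaugeHom (gaugeExp ((0 : ℝ) • θ))).1 p = 1 := fun θ => by
    rw [zero_smul]
    exact NormedSpace.exp_zero
  have e1 : (gaugeHom (gaugeExp ((0 : ℝ) • θ))⁻¹).1 p = 1 := by
    rw [gaugeExp_inv, ← smul_neg, e0]
  rw [e0, e1]
  refine ContinuousLinearMap.ext fun w => ?_
  simp [sub_eq_add_neg, add_comm]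

end infinitesimal
end QuiverBundle

theorem mainTheorem3 {X : Type*} [TopologicalSpace X] [T2Space X] [CompactSpace X]
    [ChartedSpace ℂ X] [IsManifold 𝓘(ℂ) ω X] (σ : QuiverBundle.AreaForm X)
    {V : Type*} [Fintype V] [Quiver V] [∀ i j : V, Fintype (i ⟶ j)]
    (E : V → QuiverBundle.HermitianBundle X) :
    -- `infAction θ` is the vector field `d/dt|₀ exp (t θ) · z`, pointwise on `X`
    (∀ (θ : QuiverBundle.GaugeAlgebra E) (z : QuiverBundle.EdgeRep E) (i j : V) (a : i ⟶ j)
      (p : X),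
      HasDerivAt (fun t : ℝ => ((t • θ).exp • z).x i j a |>.1 p)
        ((QuiverBundle.infAction θ z).x i j a |>.1 p) 0 ∧
      ∀ w : Fin 2 → QuiverBundle.TangentPlane X p,
        HasDerivAt (fun t : ℝ => ((t • θ).exp • z).y i j a |>.1 p w)
          ((QuiverBundle.infAction θ z).y i j a |>.1 p w) 0) ∧
    -- the components of the real moment map are self-adjoint
    (∀ (z : QuiverBundle.EdgeRep E) (i : V),
      QuiverBundle.HomSection.adj (QuiverBundle.muR σ z i) = QuiverBundle.muR σ z i) ∧
    -- the action is Hamiltonian for the real symplectic form, with moment map `muR`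
    QuiverBundle.IsHamiltonianAction ℝ QuiverBundle.GaugeGroup.ad
      (QuiverBundle.infAction (E := E)) (QuiverBundle.omegaR σ)
      (fun z θ => QuiverBundle.pairR σ (QuiverBundle.muR σ z) θ) ∧
    -- and for the complex symplectic form, with moment map `muC`
    QuiverBundle.IsHamiltonianAction ℂ QuiverBundle.GaugeGroup.ad
      (QuiverBundle.infAction (E := E)) QuiverBundle.omegaC
      (fun z θ => QuiverBundle.pairC (QuiverBundle.muC z) θ) := by
  refine ⟨fun θ z i j a p => ⟨?_, fun w => ?_⟩, QuiverBundle.adj_muR σ,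
    QuiverBundle.isHamiltonianAction_omegaR σ, QuiverBundle.isHamiltonianAction_omegaC σ⟩
  · exact QuiverBundle.hasDerivAt_gaugeExp_conj (θ j) (θ i) p ((z.x i j a).1 p)
  -- On fixed tangent vectors `w` the two-form is a single fibre map, so the same product rule
  -- applies with head and tail exchanged.
  · exact QuiverBundle.hasDerivAt_gaugeExp_conj (θ i) (θ j) p ((z.y i j a).1 p w)
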